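/- **Setting.** Let $\mathbb K\in\{\mathbb R,\mathbb C\}$. For every $d\in\mathbb N=\{1,2,\dots\}$ let $D_d\subset\mathbb R^d$ be a Borel set, $\rho_d$ a probability density (with respect to Lebesgue measure) on $D_d$, $G_d=L_2(D_d,\rho_d(x)\,dx)$, and let $F_d$ be a separable Hilbert space of $\mathbb K$-valued functions on $D_d$ that is compactly embedded in $G_d$ by $\mathrm{APP}_d f=f$ (function evaluations need not be continuous on $F_d$). Let $\mathrm{APP}=\{\mathrm{APP}_d\}_{d\in\mathbb N}$. Let $\Lambda^{\rm all}$ be the class of all linear functionals on $F_d$ (continuous or not) and $\Lambda^{\rm std}$ the class of all function evaluations $f\mapsto f(x)$, $x\in D_d$. *Worst case setting.* For $n\ge1$ let $e^{\rm wor}(n,d;\Lambda)$ be the infimum of $\sup_{\|f\|_{F_d}\le1}\|f-A(f)\|_{G_d}$ over all $A(f)=\phi(L_1(f),\dots,L_n(f))$ with $L_j\in\Lambda$ and $\phi:\mathbb K^n\to G_d$ measurable. *Randomized setting.* A randomized algorithm has the form $A^\omega(f)=\phi_\omega(L_{1,\omega}(f),\dots,L_{n,\omega}(f))$ with $n=n(f,\omega)\in\mathbb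 N_0$, where $\omega$ is a random element of a probability space, $L_{j,\omega}\in\Lambda$, and for each $\omega$ and each number $k$ of arguments $\phi_\omega:\mathbb K^k\to G_d$ is measurable; whether the algorithm stops after $k$ evaluations is determined by $\omega$ and the $k$ values observed so far; $n(f,\omega)$ and $A^\omega(f)$ are jointly measurable in $(f,\omega)$ for $f$ in any finite-dimensional subspace of $F_d$. For $n\ge1$ let $e^{\rm ran}(n,d;\Lambda)$ be the infimum of $\sup_{\|f\|_{F_d}\le1}\big(\mathbb E_\omega\|f-A^\omega(f)\|_{G_d}^2\big)^{1/2}$ over all randomized algorithms with $\sup_{\|f\|_{F_d}\le1}\mathbb E_\omega\, n(f,\omega)\le n$. For $n=0$ only the zero algorithm is used: $e^{\rm wor}(0,d;\Lambda)=e^{\rm ran}(0,d;\Lambda)=\sup_{\|f\|_{F_d}\le1}\|f\|_{G_d}$. *Information complexity.* For $\diamond\in\{{\rm wor},{\rm ran}\}$ and $\star\in\{{\rm ABS},{\rm NOR}\}$ let $$n^{\diamond,\star}(\varepsilon,d;\Lambda)=\min\{n\in\mathbb N_0:\ e^{\diamond}(n,d;\Lambda)\le\varepsilon\,{\rm CRI}_d\},$$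 where ${\rm CRI}_d=1$ for $\star={\rm ABS}$ and ${\rm CRI}_d=e^\diamond(0,d;\Lambda)$ for $\star={\rm NOR}$. *Notions of tractability.* Put $T(\varepsilon)=\varepsilon^{-1}$ for ALG notions and $T(\varepsilon)=1+\ln\varepsilon^{-1}$ for EXP notions. With $n(\varepsilon,d)=n^{\diamond,\star}(\varepsilon,d;\Lambda)$, always for $\varepsilon\in(0,1)$, $d\in\mathbb N$, and with the convention $\ln 0=0$, APP is - SPT if there are $C>0$, $p\ge0$ with $n(\varepsilon,d)\le C\,T(\varepsilon)^p$ for all $\varepsilon,d$; the exponent of SPT is the infimum of such $p$ ($\infty$ if there are none); - PT if there are $C>0$, $p,q\ge0$ with $n(\varepsilon,d)\le C\,d^{\,q}\,T(\varepsilon)^p$ for all $\varepsilon,d$; - QPT if there are $C>0$, $t\ge0$ with $n(\varepsilon,d)\le C\exp\big(t(1+\ln d)(1+\ln T(\varepsilon))\big)$ for all $\varepsilon,d$; the exponent of QPT is the infimum of such $t$ ($\infty$ if there are none); - $(s,t)$-WT, for fixed $s,t>0$, if $\displaystyle\lim_{\varepsilon^{-1}+d\to\infty}\frac{\ln n(\varepsilon,d)}{T(\varepsilon)^s+d^{\,t}}=0$;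 WT if this holds with $s=t=1$; UWT if it holds for all $s,t>0$. **Corollary 2.7.** Let $\star\in\{{\rm ABS},{\rm NOR}\}$. The information complexities $n^{\rm wor,\star}(\varepsilon,d;\Lambda^{\rm all})$, $n^{\rm ran,\star}(\varepsilon,d;\Lambda^{\rm all})$, $n^{\rm ran,\star}(\varepsilon,d;\Lambda^{\rm std})$ are finite for all $\varepsilon\in(0,1)$ and $d\in\mathbb N$, and: 1. Each of ALG-SPT, ALG-PT, ALG-QPT, ALG-UWT, ALG-WT, and ALG-$(s,t)$-WT for any fixed $s,t>0$, holds in the worst case setting for $\Lambda^{\rm all}$ if and only if it holds in the randomized setting for $\Lambda^{\rm all}$, if and only if it holds in the randomized setting for $\Lambda^{\rm std}$. 2. The same is true of each of EXP-SPT, EXP-PT, EXP-QPT, EXP-UWT, EXP-WT, and EXP-$(s,t)$-WT for any fixed $s,t>0$. 3. The exponents of ALG-SPT, of ALG-QPT, of EXP-SPT and of EXP-QPT are each the same in the worst case setting for $\Lambda^{\rm all}$, in the randomized setting for $\Lambda^{\rm all}$, and in the randomized setting for $\Lambda^{\rm std}$. -/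

import Mathlib

open MeasureTheory Filter Topology
open scoped ENNReal NNReal

noncomputable section

namespace Tractability

/-- The `L₂`-approximation problem in dimension `d`: a Borel domain `D ⊆ ℝ^d`, a probability
density `ρ` on `D` with respect to Lebesgue measure, and a separable Hilbert space `F` of functions
on `D` (`toFun` sends an element of `F` to the function that it is) which is compactly
embedded in `L₂(D, ρ(x) dx)`. Point evaluations need not be continuous on `F`. -/
structure ApproxProblem (𝕜 : Type*) [RCLike 𝕜] (d : ℕ) where
  D : Set (Fin d → ℝ)
  measurableSet_D : MeasurableSet D
  ρ : D → ℝ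
  measurable_ρ : Measurable ρ
  ρ_nonneg : ∀ x, 0 ≤ ρ x
  lintegral_ρ : ∫⁻ x, ENNReal.ofReal (ρ x) ∂((volume : Measure (Fin d → ℝ)).comap Subtype.val) = 1
  F : Type
  [normedAddCommGroup : NormedAddCommGroup F]
  [innerProductSpace : InnerProductSpace 𝕜 F]
  [completeSpace : CompleteSpace F]
  [separableSpace : TopologicalSpace.SeparableSpace F]
  toFun : F →ₗ[𝕜] (D → 𝕜)
  toFun_injective : Function.Injective toFun
  memLp : ∀ f, MemLp (toFun f) 2
    (((volume : Measure (Fin d → ℝ)).comap Subtype.val).withDensity fun x => ENNReal.ofReal (ρ x))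
  isCompactOperator : IsCompactOperator fun f => (memLp f).toLp (toFun f)

attribute [instance] ApproxProblem.normedAddCommGroup ApproxProblem.innerProductSpace
  ApproxProblem.completeSpace ApproxProblem.separableSpace

/-- The classes `Λ^all` and `Λ^std` of admissible information. -/
inductive InfoClass
  | all
  | std

/-- The worst case and the randomized setting. -/
inductive Setting
  | wor
  | ran

/-- The absolute and the normalized error criterion. -/
inductive Criterion
  | abs
  | nor

/-- Algebraic and exponential tractability. -/
inductive Scale
  | alg
  | exp

namespace ApproxProblem

variable {𝕜 : Type*} [RCLike 𝕜] {d : ℕ} (P : ApproxProblem 𝕜 d)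

/-- The probability measure `ρ(x) dx` on `D`. -/
def μ : Measure P.D :=
  ((volume : Measure (Fin d → ℝ)).comap Subtype.val).withDensity fun x => ENNReal.ofReal (P.ρ x)

/-- The target space `G = L₂(D, ρ(x) dx)`. -/
abbrev G : Type _ := Lp 𝕜 2 P.μ

/-- The embedding `APP : F → G`, `APP f = f`. -/
def app (f : P.F) : P.G := (P.memLp f).toLp (P.toFun f)

/-- `Λ^all` consists of all linear functionals on `F` (continuous or not), `Λ^std` of the function
values `f ↦ f x`, `x ∈ D`. -/
def functionals : InfoClass → Set (P.F →ₗ[𝕜] 𝕜)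
  | .all => Set.univ
  | .std => {L | ∃ x : P.D, ∀ f, L f = P.toFun f x}

/-- The initial error, i.e. the error of the zero algorithm. -/
def initialError : ℝ≥0∞ := ⨆ (f : P.F) (_ : ‖f‖ ≤ 1), ‖P.app f‖ₑ

/-- A deterministic algorithm `f ↦ φ (L₁ f, …, Lₙ f)`. -/
structure DetAlgorithm (Λ : InfoClass) (n : ℕ) where
  L : Fin n → (P.F →ₗ[𝕜] 𝕜)
  L_mem : ∀ j, L j ∈ P.functionals Λ
  φ : (Fin n → 𝕜) → P.G
  stronglyMeasurable_φ : StronglyMeasurable φ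

/-- The worst case error of a deterministic algorithm. -/
def DetAlgorithm.error {P : ApproxProblem 𝕜 d} {Λ : InfoClass} {n : ℕ}
    (A : P.DetAlgorithm Λ n) : ℝ≥0∞ :=
  ⨆ (f : P.F) (_ : ‖f‖ ≤ 1), ‖P.app f - A.φ fun j => A.L j f‖ₑ

/-- A randomized algorithm `f ↦ φ_ω (L_{1,ω} f, …, L_{n,ω} f)` with `n = n(f, ω)`.

The number `n(f, ω)` of information evaluations may depend on `ω` and, adaptively, on `f`: whether
the algorithm stops after `k` evaluations is decided by the `k` values observed so far, which is
what `n_congr` says. The number of evaluations and the output are jointly measurable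
in `ω` and `f`, where `f` runs through a finite-dimensional subspace (a finite-dimensional
subspace carries only one reasonable Borel structure, and on it all functionals are measurable,
which need not be so on `F`). -/
structure RandAlgorithm (Λ : InfoClass) where
  Ω : Type
  [measurableSpace : MeasurableSpace Ω]
  ℙ : Measure Ω
  [isProbabilityMeasure : IsProbabilityMeasure ℙ]
  L : ℕ → Ω → (P.F →ₗ[𝕜] 𝕜)
  L_mem : ∀ j ω, L j ω ∈ P.functionals Λ
  n : P.F → Ω → ℕ
  n_congr : ∀ ω f g, (∀ j < n f ω, L j ω g = L j ω f) → n g ω = n f ω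
  φ : Ω → (k : ℕ) → (Fin k → 𝕜) → P.G
  stronglyMeasurable_φ : ∀ ω k, StronglyMeasurable (φ ω k)
  measurable_n : ∀ (k : ℕ) (v : Fin k → P.F),
    Measurable fun p : (Fin k → 𝕜) × Ω => n (∑ i, p.1 i • v i) p.2
  stronglyMeasurable_output : ∀ (k : ℕ) (v : Fin k → P.F),
    StronglyMeasurable fun p : (Fin k → 𝕜) × Ω =>
      φ p.2 (n (∑ i, p.1 i • v i) p.2) fun j => L j p.2 (∑ i, p.1 i • v i)

attribute [instance] RandAlgorithm.measurableSpace RandAlgorithm.isProbabilityMeasure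

namespace RandAlgorithm

variable {P} {Λ : InfoClass} (A : P.RandAlgorithm Λ)

/-- The output of the algorithm for the input `f` and the random element `ω`. -/
def output (f : P.F) (ω : A.Ω) : P.G := A.φ ω (A.n f ω) fun j => A.L j ω f

/-- The cardinality `sup_{‖f‖ ≤ 1} 𝔼 n(f, ω)`. -/
def card : ℝ≥0∞ := ⨆ (f : P.F) (_ : ‖f‖ ≤ 1), ∫⁻ ω, (A.n f ω : ℝ≥0∞) ∂A.ℙ

/-- The randomized error `sup_{‖f‖ ≤ 1} (𝔼 ‖f - A_ω f‖²)^{1/2}`. -/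
def error : ℝ≥0∞ :=
  ⨆ (f : P.F) (_ : ‖f‖ ≤ 1), (∫⁻ ω, ‖P.app f - A.output f ω‖ₑ ^ 2 ∂A.ℙ) ^ (1 / 2 : ℝ)

end RandAlgorithm

/-- The `n`th minimal error; for `n = 0` only the zero algorithm is used. -/
def minError (σ : Setting) (Λ : InfoClass) (n : ℕ) : ℝ≥0∞ :=
  if n = 0 then P.initialError
  else match σ with
    | .wor => ⨅ A : P.DetAlgorithm Λ n, A.error
    | .ran => ⨅ (A : P.RandAlgorithm Λ) (_ : A.card ≤ n), A.error

/-- The factor `CRI`. -/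
def cri (σ : Setting) (Λ : InfoClass) : Criterion → ℝ≥0∞
  | .abs => 1
  | .nor => P.minError σ Λ 0

/-- The set of all `n` for which the error demand `ε` is met. -/
def admissible (σ : Setting) (Λ : InfoClass) (c : Criterion) (ε : ℝ) : Set ℕ :=
  {n | P.minError σ Λ n ≤ ENNReal.ofReal ε * P.cri σ Λ c}

/-- The information complexity in dimension `d`. -/
def infoComplexity (σ : Setting) (Λ : InfoClass) (c : Criterion) (ε : ℝ) : ℕ :=
  sInf (P.admissible σ Λ c ε)

end ApproxProblem

/-- The information complexity `n(ε, d)` of a sequence of problems. -/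
def complexity {𝕜 : Type*} [RCLike 𝕜] (APP : (d : ℕ+) → ApproxProblem 𝕜 d)
    (σ : Setting) (Λ : InfoClass) (c : Criterion) (ε : ℝ) (d : ℕ+) : ℕ :=
  (APP d).infoComplexity σ Λ c ε

/-- The quantity in terms of which the dependence on `ε` is measured: `ε⁻¹` for algebraic and
`1 + ln ε⁻¹` for exponential tractability. -/
def Scale.size : Scale → ℝ → ℝ
  | .alg, ε => ε⁻¹
  | .exp, ε => 1 + Real.log ε⁻¹

section Notions

variable (s : Scale) (N : ℝ → ℕ+ → ℕ)

/-- `N(ε, d) ≤ C · size(ε)^p` for all `d` and `ε`, for some `C > 0`. -/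
def SPTBound (p : ℝ≥0) : Prop :=
  ∃ C : ℝ, 0 < C ∧ ∀ (d : ℕ+) (ε : ℝ), 0 < ε → ε < 1 → (N ε d : ℝ) ≤ C * s.size ε ^ (p : ℝ)

/-- Strong polynomial tractability. -/
def SPT : Prop := ∃ p : ℝ≥0, SPTBound s N p

/-- The exponent of strong polynomial tractability (`∞` if this property fails). -/
def sptExponent : ℝ≥0∞ := ⨅ (p : ℝ≥0) (_ : SPTBound s N p), (p : ℝ≥0∞)

/-- Polynomial tractability. -/
def PT : Prop :=
  ∃ (C : ℝ) (p q : ℝ≥0), 0 < C ∧ ∀ (d : ℕ+) (ε : ℝ), 0 < ε → ε < 1 →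
    (N ε d : ℝ) ≤ C * (d : ℝ) ^ (q : ℝ) * s.size ε ^ (p : ℝ)

/-- `N(ε, d) ≤ C · exp (t (1 + ln d) (1 + ln size(ε)))` for all `d` and `ε`, for some `C > 0`. -/
def QPTBound (t : ℝ≥0) : Prop :=
  ∃ C : ℝ, 0 < C ∧ ∀ (d : ℕ+) (ε : ℝ), 0 < ε → ε < 1 →
    (N ε d : ℝ) ≤ C * Real.exp (t * (1 + Real.log d) * (1 + Real.log (s.size ε)))

/-- Quasi-polynomial tractability. -/
def QPT : Prop := ∃ t : ℝ≥0, QPTBound s N t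

/-- The exponent of quasi-polynomial tractability (`∞` if this property fails). -/
def qptExponent : ℝ≥0∞ := ⨅ (t : ℝ≥0) (_ : QPTBound s N t), (t : ℝ≥0∞)

/-- The filter `ε⁻¹ + d → ∞` with `ε ∈ (0, 1)`. -/
def limitFilter : Filter (ℝ × ℕ+) :=
  comap (fun x => x.1⁻¹ + (x.2 : ℝ)) atTop ⊓ 𝓟 {x | 0 < x.1 ∧ x.1 < 1}

/-- `(α, β)`-weak tractability; here `ln 0 = 0`. -/
def STWT (α β : ℝ) : Prop :=
  Tendsto (fun x : ℝ × ℕ+ => Real.log (N x.1 x.2) / (s.size x.1 ^ α + (x.2 : ℝ) ^ β))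
    limitFilter (𝓝 0)

/-- Uniform weak tractability. -/
def UWT : Prop := ∀ α β : ℝ, 0 < α → 0 < β → STWT s N α β

/-- Weak tractability; here `ln 0 = 0`. -/
def WT : Prop :=
  Tendsto (fun x : ℝ × ℕ+ => Real.log (N x.1 x.2) / (s.size x.1 + (x.2 : ℝ)))
    limitFilter (𝓝 0)

end Notions

end Tractability

end

open Tractability

/-! The three complexities dominate one another in a cycle, each step costing only an arbitrarily
small loss: `N₁ ε d ≤ C * N₂ (δ * ε) d ^ (1 + η)` for all `δ < 1` and `η > 0`, with `C` independent
of `ε` and `d`. Every notion of tractability is inherited under `Dominated`, and the two exponents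
can only drop, so closing the cycle gives all equivalences and all equalities.

The link between settings is `exists_spectral_splitting`: compactness of the embedding yields, for
each threshold `τ > 0`, a finite-dimensional `W` on which the embedding expands by at least `τ`,
while it expands by at most `τ` on `Wᗮ`. The dimension of `W` is compared with each complexity.

Worst case by randomized with arbitrary information: projecting onto `W` costs `dim W` functionals.
Conversely, average over a rotation-invariant measure on the unit sphere of `W`. Reflecting an input
in the orthogonal complement of the common kernel of `k` functionals leaves those data unchanged, so
the error is at least `τ` times the norm of the projection onto that kernel, whose mean square is at
least `1 - k / dim W`. Markov's inequality handles a random number of evaluations. Hence `dim W > K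
^ 2 * n` is impossible for an algorithm of cost `n` and error below `√(1 - 2 / K) * τ`
(`le_minError_ran`).

Randomized with arbitrary information by randomized with function values: function values are a
special case.

Randomized with function values by worst case: let `V`, of dimension `n`, be the image of `W` in
`L₂`. Interpolation at nodes drawn with density proportional to a squared determinant recovers the
coefficients with mean square error at most `n` times the squared distance to `V`. Importance
sampling with `n * K` points has mean square error at most `‖f‖² / K`; applied repeatedly to the
residual it reduces the factor `n` to `3 / K` after about `log₂ n` rounds (`minError_ran_std_le`).
The cost `n * (1 + K * (log₂ n + 1))`, up to rounding, is absorbed into `C * n ^ (1 + η)`, and a bad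
input `±f` from `W` shows that `dim W` is at most the worst case complexity. -/

noncomputable section

namespace Tractability

/-! ### Spectral splitting of a compact operator -/

section SpectralSplitting

section Spectral

open Module

variable {𝕜 E H : Type*} [RCLike 𝕜] [NormedAddCommGroup E] [InnerProductSpace 𝕜 E]
  [NormedAddCommGroup H] [InnerProductSpace 𝕜 H]

/-- Eigenspaces of a symmetric operator are orthogonal, so norm and quadratic form are diagonal in
the eigencomponents. The predicate `p` lets the same computation serve eigenvalues above and below
the threshold. Only real parts occur, so the eigenvalues need not be shown to be real. -/
lemma exists_sum_of_mem_iSup_eigenspace {S : End 𝕜 E} {p : 𝕜 → Prop} {f : E}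
    (hf : f ∈ ⨆ l : {l : 𝕜 // p l}, End.eigenspace S l) (hS : S.IsSymmetric) :
    ∃ (s : Finset {l : 𝕜 // p l}) (v : {l : 𝕜 // p l} → E), f = ∑ l ∈ s, v l ∧
      ‖f‖ ^ 2 = ∑ l ∈ s, ‖v l‖ ^ 2 ∧
      RCLike.re (inner 𝕜 (S f) f) = ∑ l ∈ s, RCLike.re (l : 𝕜) * ‖v l‖ ^ 2 := by
  obtain ⟨g, hg, rfl⟩ := (Submodule.mem_iSup_iff_exists_finsupp _ _).1 hf
  have hV := hS.orthogonalFamily_eigenspaces.comp (f := fun l : {l : 𝕜 // p l} => (l : 𝕜))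
    Subtype.coe_injective
  have h1 := hV.norm_sum (fun l => ⟨g l, hg l⟩) g.support
  have h2 : inner 𝕜 (∑ l ∈ g.support, (l : 𝕜) • g l) (∑ l ∈ g.support, g l) =
      ∑ l ∈ g.support, inner 𝕜 ((l : 𝕜) • g l) (g l) :=
    hV.inner_sum (fun l => (l : 𝕜) • ⟨g l, hg l⟩) (fun l => ⟨g l, hg l⟩) g.support
  refine ⟨g.support, g, rfl, h1, ?_⟩
  have h3 : S (g.sum fun _ x => x) = ∑ l ∈ g.support, (l : 𝕜) • g l := by
    rw [Finsupp.sum, map_sum]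
    exact Finset.sum_congr rfl fun l _ => End.mem_eigenspace_iff.1 (hg l)
  rw [h3, Finsupp.sum, h2, map_sum]
  refine Finset.sum_congr rfl fun l _ => ?_
  rw [inner_smul_left, inner_self_eq_norm_sq_to_K, ← RCLike.ofReal_pow, RCLike.re_mul_ofReal, RCLike.conj_re]

variable [CompleteSpace E]

/-- A compact operator that is bounded below on a subspace forces the latter to have finite
dimension. -/
lemma finiteDimensional_of_boundedBelow (T : E →L[𝕜] H) (hT : IsCompactOperator T)
    (W : Submodule 𝕜 E) {τ : ℝ} (hτ : 0 < τ) (hW : ∀ f ∈ W, τ * ‖f‖ ≤ ‖T f‖) :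
    FiniteDimensional 𝕜 W := by
  have hWc : ∀ f ∈ W.topologicalClosure, τ * ‖f‖ ≤ ‖T f‖ := by
    intro f hf
    have hcl : IsClosed {f : E | τ * ‖f‖ ≤ ‖T f‖} :=
      isClosed_le (by fun_prop) (by fun_prop)
    exact closure_minimal (fun x hx => hW x hx) hcl hf
  have : CompleteSpace W.topologicalClosure :=
    W.isClosed_topologicalClosure.completeSpace_coe
  let S : W.topologicalClosure →L[𝕜] H := T ∘L W.topologicalClosure.subtypeL
  have hS : IsCompactOperator S := hT.comp_clm W.topologicalClosure.subtypeL
  have hanti : AntilipschitzWith (Real.toNNReal τ⁻¹) S := by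
    refine ContinuousLinearMap.antilipschitz_of_bound S (fun x => ?_)
    rw [Real.coe_toNNReal _ (inv_nonneg.2 hτ.le), inv_mul_eq_div, le_div_iff₀' hτ]
    exact hWc x x.2
  -- A closed embedding pulls the compact set back to a compact neighbourhood of `0`, so the
  -- identity is compact. Passing to the closure of `W` supplied the completeness needed here.
  have hemb : IsClosedEmbedding S := hanti.isClosedEmbedding S.uniformContinuous
  have hid : IsCompactOperator (id : W.topologicalClosure → W.topologicalClosure) := by
    obtain ⟨K, hK, hK0⟩ := hS
    exact ⟨S ⁻¹' K, hemb.isCompact_preimage hK, hK0⟩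
  have : FiniteDimensional 𝕜 W.topologicalClosure := .of_isCompactOperator_id hid
  exact Submodule.finiteDimensional_of_le W.le_topologicalClosure

variable [CompleteSpace H]

/-- The domain of a compact operator splits into a subspace of finite dimension on which the
operator expands by more than `τ` and an orthogonal complement on which it expands by at
most `τ`. -/
theorem exists_spectral_splitting (T : E →L[𝕜] H) (hT : IsCompactOperator T) {τ : ℝ}
    (hτ : 0 < τ) :
    ∃ W : Submodule 𝕜 E, FiniteDimensional 𝕜 W ∧ (∀ f ∈ W, f ≠ 0 → τ * ‖f‖ < ‖T f‖) ∧
      ∀ f ∈ Wᗮ, ‖T f‖ ≤ τ * ‖f‖ := by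
  let S : E →L[𝕜] E := T.adjoint ∘L T
  have hSc : IsCompactOperator S := hT.clm_comp T.adjoint
  have hSs : (S : End 𝕜 E).IsSymmetric := by
    intro x y
    simp [S, ContinuousLinearMap.adjoint_inner_left, ContinuousLinearMap.adjoint_inner_right]
  have hquad : ∀ f, RCLike.re (inner 𝕜 ((S : End 𝕜 E) f) f) = ‖T f‖ ^ 2 := by
    intro f
    simp [S, ContinuousLinearMap.adjoint_inner_left]
  let W : Submodule 𝕜 E :=
    ⨆ l : {l : 𝕜 // τ ^ 2 < RCLike.re l}, End.eigenspace (S : End 𝕜 E) l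
  let W' : Submodule 𝕜 E :=
    ⨆ l : {l : 𝕜 // ¬ τ ^ 2 < RCLike.re l}, End.eigenspace (S : End 𝕜 E) l
  have hW : ∀ f ∈ W, f ≠ 0 → τ * ‖f‖ < ‖T f‖ := by
    intro f hf hf0
    obtain ⟨s, v, -, hn, hq⟩ := exists_sum_of_mem_iSup_eigenspace hf hSs
    rw [hquad] at hq
    refine lt_of_pow_lt_pow_left₀ 2 (norm_nonneg _) ?_
    rw [mul_pow, hq, hn, Finset.mul_sum]
    refine Finset.sum_lt_sum (fun l _ => by gcongr; exact l.2.le) ?_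
    by_contra! h
    have h0 : ∀ l ∈ s, ‖v l‖ ^ 2 = 0 := fun l hl => by
      have := h l hl
      have hl2 := l.2
      by_contra hne
      have hp : 0 < ‖v l‖ ^ 2 := lt_of_le_of_ne (by positivity) (Ne.symm hne)
      nlinarith
    rw [Finset.sum_eq_zero h0] at hn
    exact hf0 (by simpa using hn)
  have hW' : ∀ f ∈ W', ‖T f‖ ≤ τ * ‖f‖ := by
    intro f hf
    obtain ⟨s, v, -, hn, hq⟩ := exists_sum_of_mem_iSup_eigenspace hf hSs
    rw [hquad] at hq
    refine le_of_sq_le_sq ?_ (by positivity)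
    rw [mul_pow, hq, hn, Finset.mul_sum]
    refine Finset.sum_le_sum fun l _ => by gcongr; exact not_lt.1 l.2
  have horth : W' ≤ Wᗮ := by
    rw [← Submodule.isOrtho_iff_le]
    refine Submodule.isOrtho_iSup_left.2 fun i => Submodule.isOrtho_iSup_right.2 fun j => ?_
    refine hSs.orthogonalFamily_eigenspaces.isOrtho ?_
    intro hij
    exact i.2 (hij ▸ j.2)
  -- By the spectral theorem the eigenspaces span a dense subspace. Hence an element of `Wᗮ` equals
  -- its projection onto the closure of `W'`, to which the bound on `W'` extends by continuity.
  have hbot : Wᗮ ⊓ W'ᗮ = ⊥ := by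
    rw [Submodule.inf_orthogonal, eq_bot_iff,
      ← ContinuousLinearMap.orthogonalComplement_iSup_eigenspaces_eq_bot hSc hSs]
    refine Submodule.orthogonal_le (iSup_le fun l => ?_)
    by_cases hl : τ ^ 2 < RCLike.re l
    · exact le_sup_of_le_left
        (le_iSup (fun l : {l : 𝕜 // τ ^ 2 < RCLike.re l} => End.eigenspace (S : End 𝕜 E) l)
          ⟨l, hl⟩)
    · exact le_sup_of_le_right
        (le_iSup (fun l : {l : 𝕜 // ¬ τ ^ 2 < RCLike.re l} => End.eigenspace (S : End 𝕜 E) l)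
          ⟨l, hl⟩)
  refine ⟨W, ?_, hW, ?_⟩
  · refine finiteDimensional_of_boundedBelow T hT W hτ fun f hf => ?_
    by_cases h0 : f = 0
    · simp [h0]
    · exact (hW f hf h0).le
  · have hle : W'.topologicalClosure ≤ Wᗮ :=
      Submodule.topologicalClosure_minimal _ horth W.isClosed_orthogonal
    have : CompleteSpace W'.topologicalClosure :=
      W'.isClosed_topologicalClosure.completeSpace_coe
    intro f hf
    have hmem : f - W'.topologicalClosure.starProjection f ∈ Wᗮ ⊓ W'ᗮ := by
      refine ⟨Submodule.sub_mem _ hf (hle (Submodule.starProjection_apply_mem _ f)), ?_⟩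
      exact Submodule.orthogonal_le W'.le_topologicalClosure
        (Submodule.sub_starProjection_mem_orthogonal f)
    rw [hbot, Submodule.mem_bot, sub_eq_zero] at hmem
    have hf' : f ∈ W'.topologicalClosure := by
      rw [hmem]; exact Submodule.starProjection_apply_mem _ f
    have hcl : IsClosed {f : E | ‖T f‖ ≤ τ * ‖f‖} :=
      isClosed_le (by fun_prop) (by fun_prop)
    exact closure_minimal (fun x hx => hW' x hx) hcl hf'

end Spectral

end SpectralSplitting

/-! ### Inheritance of tractability under domination -/

section Transfer

section Comparison

/-- `N₁` is dominated by `N₂` up to an arbitrarily small loss in the exponent and in the factor in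
front of the error demand. -/
def Dominated (N₁ N₂ : ℝ → ℕ+ → ℕ) : Prop :=
  ∀ δ η : ℝ, 0 < δ → δ < 1 → 0 < η → ∃ C : ℝ, 0 < C ∧ ∀ (d : ℕ+) (ε : ℝ), 0 < ε → ε < 1 →
    (N₁ ε d : ℝ) ≤ C * (N₂ (δ * ε) d : ℝ) ^ (1 + η)

lemma Scale.one_le_size (s : Scale) {ε : ℝ} (h0 : 0 < ε) (h1 : ε < 1) : 1 ≤ s.size ε := by
  have h : 1 ≤ ε⁻¹ := (one_le_inv₀ h0).2 h1.le
  cases s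
  · exact h
  · have := Real.log_nonneg h
    simp only [Scale.size]
    linarith

/-- Shrinking the error demand by a fixed factor thus costs a constant factor on either scale. In
the exponential case this is `1 + a + b ≤ (1 + a) * (1 + b)`. -/
lemma Scale.size_mul_le (s : Scale) {δ ε : ℝ} (hδ0 : 0 < δ) (hδ1 : δ < 1) (h0 : 0 < ε)
    (h1 : ε < 1) : s.size (δ * ε) ≤ s.size δ * s.size ε := by
  cases s
  · simp [Scale.size, mul_comm]
  · have ha : 0 ≤ Real.log δ⁻¹ := Real.log_nonneg ((one_le_inv₀ hδ0).2 hδ1.le)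
    have hb : 0 ≤ Real.log ε⁻¹ := Real.log_nonneg ((one_le_inv₀ h0).2 h1.le)
    simp only [Scale.size]
    rw [mul_inv, Real.log_mul (by positivity) (by positivity)]
    nlinarith

lemma Scale.exists_size_eq (s : Scale) {κ : ℝ} (hκ : 1 < κ) :
    ∃ δ : ℝ, 0 < δ ∧ δ < 1 ∧ s.size δ = κ := by
  cases s
  · exact ⟨κ⁻¹, by positivity, inv_lt_one_of_one_lt₀ hκ, by simp [Scale.size]⟩
  · refine ⟨Real.exp (-(κ - 1)), Real.exp_pos _, by simpa using hκ, ?_⟩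
    simp [Scale.size, ← Real.exp_neg]

variable {s : Scale} {N₁ N₂ : ℝ → ℕ+ → ℕ}

/-- The loss in `ε` only changes the constant, so `δ = 1 / 2` will do; the power `1 + η = κ` is what
multiplies the exponent. -/
lemma SPTBound.of_dominated {p : ℝ≥0} (h : SPTBound s N₂ p) (hN : Dominated N₁ N₂) {κ : ℝ≥0}
    (hκ : 1 < κ) : SPTBound s N₁ (κ * p) := by
  obtain ⟨C₂, hC₂, h⟩ := h
  obtain ⟨C, hC, hN⟩ := hN (1 / 2) (κ - 1) (by norm_num) (by norm_num)
    (by have : (1 : ℝ) < κ := by exact_mod_cast hκ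
        linarith)
  have hσ : 1 ≤ s.size (1 / 2) := s.one_le_size (by norm_num) (by norm_num)
  refine ⟨C * (C₂ * s.size (1 / 2) ^ (p : ℝ)) ^ (κ : ℝ), by positivity, fun d ε h0 h1 => ?_⟩
  have hT := s.one_le_size h0 h1
  have hT' : 1 ≤ s.size (1 / 2 * ε) := s.one_le_size (by positivity) (by linarith)
  calc (N₁ ε d : ℝ) ≤ C * (N₂ (1 / 2 * ε) d : ℝ) ^ (κ : ℝ) := by
        simpa using hN d ε h0 h1
    _ ≤ C * (C₂ * (s.size (1 / 2) * s.size ε) ^ (p : ℝ)) ^ (κ : ℝ) := by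
        gcongr
        refine (h d _ (by positivity) (by linarith)).trans ?_
        gcongr
        exact s.size_mul_le (by norm_num) (by norm_num) h0 h1
    _ = _ := by
        rw [Real.mul_rpow (z := (p : ℝ)) (by positivity) (by positivity), ← mul_assoc,
          Real.mul_rpow (z := (κ : ℝ)) (x := C₂ * _) (by positivity) (by positivity),
          ← Real.rpow_mul (x := s.size ε) (by positivity), NNReal.coe_mul, mul_comm (κ : ℝ)]
        ring

lemma SPT.of_dominated (h : SPT s N₂) (hN : Dominated N₁ N₂) : SPT s N₁ := by
  obtain ⟨p, h⟩ := h
  exact ⟨_, h.of_dominated hN one_lt_two⟩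

/-- Let `κ` decrease to `1`: a loss by every factor above `1` is invisible to the infimum. -/
lemma ennreal_iInf_le_of_forall_mul {P Q : ℝ≥0 → Prop}
    (h : ∀ p, Q p → ∀ κ : ℝ≥0, 1 < κ → P (κ * p)) :
    ⨅ (p : ℝ≥0) (_ : P p), (p : ℝ≥0∞) ≤ ⨅ (p : ℝ≥0) (_ : Q p), (p : ℝ≥0∞) := by
  refine le_iInf₂ fun p hp => ?_
  have hcont : Tendsto (fun κ : ℝ≥0 => ((κ * p : ℝ≥0) : ℝ≥0∞)) (𝓝[>] 1) (𝓝 ((1 * p : ℝ≥0) : ℝ≥0∞)) :=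
    ENNReal.tendsto_coe.2
      ((Continuous.tendsto (by fun_prop) 1).mono_left nhdsWithin_le_nhds)
  rw [one_mul] at hcont
  refine ge_of_tendsto hcont ?_
  filter_upwards [self_mem_nhdsWithin] with κ hκ
  exact iInf₂_le _ (h p hp κ hκ)

lemma sptExponent_le_of_dominated (hN : Dominated N₁ N₂) : sptExponent s N₁ ≤ sptExponent s N₂ :=
  ennreal_iInf_le_of_forall_mul fun _ hp _ hκ => SPTBound.of_dominated hp hN hκ

lemma PT.of_dominated (h : PT s N₂) (hN : Dominated N₁ N₂) : PT s N₁ := by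
  obtain ⟨C₂, p, q, hC₂, h⟩ := h
  obtain ⟨C, hC, hN⟩ := hN (1 / 2) 1 (by norm_num) (by norm_num) one_pos
  have hσ : 1 ≤ s.size (1 / 2) := s.one_le_size (by norm_num) (by norm_num)
  refine ⟨C * (C₂ * s.size (1 / 2) ^ (p : ℝ)) ^ (1 + 1 : ℝ), p * 2, q * 2, by positivity,
    fun d ε h0 h1 => ?_⟩
  have hT := s.one_le_size h0 h1
  have hT' : 1 ≤ s.size (1 / 2 * ε) := s.one_le_size (by positivity) (by linarith)
  calc (N₁ ε d : ℝ) ≤ C * (N₂ (1 / 2 * ε) d : ℝ) ^ (1 + 1 : ℝ) := hN d ε h0 h1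
    _ ≤ C * (C₂ * (d : ℝ) ^ (q : ℝ) * (s.size (1 / 2) * s.size ε) ^ (p : ℝ)) ^ (1 + 1 : ℝ) := by
        gcongr
        refine (h d _ (by positivity) (by linarith)).trans ?_
        gcongr
        exact s.size_mul_le (by norm_num) (by norm_num) h0 h1
    _ = _ := by
        have e : (1 + 1 : ℝ) = ((2 : ℝ≥0) : ℝ) := by norm_num
        rw [e, Real.mul_rpow (by positivity) (by positivity),
          Real.mul_rpow (by positivity) (by positivity),
          Real.mul_rpow (by positivity) (by positivity),
          Real.mul_rpow (by positivity) (by positivity),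
          Real.mul_rpow (by positivity) (by positivity),
          ← Real.rpow_mul (by positivity), ← Real.rpow_mul (by positivity),
          ← Real.rpow_mul (by positivity), NNReal.coe_mul, NNReal.coe_mul]
        ring

/-- Here the change from `ε` to `δ * ε` contributes a factor depending on `d`, which no constant
absorbs, so `δ` must be close to `1`. The loss is split as `κ = r * r`: one `r` is the power `1 +
η`, the other bounds the change of `1 + ln size` once `δ` is chosen with `ln (size δ) = r - 1`. -/
lemma QPTBound.of_dominated {t : ℝ≥0} (h : QPTBound s N₂ t) (hN : Dominated N₁ N₂) {κ : ℝ≥0}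
    (hκ : 1 < κ) : QPTBound s N₁ (κ * t) := by
  have hr : 1 < √(κ : ℝ) := by
    rw [Real.lt_sqrt zero_le_one]; simpa using hκ
  have hr2 : √(κ : ℝ) * √(κ : ℝ) = κ := Real.mul_self_sqrt κ.2
  set r := √(κ : ℝ)
  obtain ⟨C₂, hC₂, h⟩ := h
  obtain ⟨δ, hδ0, hδ1, hδ⟩ := s.exists_size_eq (κ := Real.exp (r - 1))
    (Real.one_lt_exp_iff.2 (by linarith))
  obtain ⟨C, hC, hN⟩ := hN δ (r - 1) hδ0 hδ1 (by linarith)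
  refine ⟨C * C₂ ^ r, by positivity, fun d ε h0 h1 => ?_⟩
  have hδε : δ * ε < 1 := by nlinarith
  have hT := s.one_le_size h0 h1
  have hT' : 1 ≤ s.size (δ * ε) := s.one_le_size (by positivity) hδε
  have hlog : 0 ≤ Real.log (s.size ε) := Real.log_nonneg hT
  have hd : (0 : ℝ) ≤ Real.log d := Real.log_nonneg (by exact_mod_cast (one_le : 1 ≤ d))
  have hlog' : 1 + Real.log (s.size (δ * ε)) ≤ r * (1 + Real.log (s.size ε)) := by
    have h3 := Real.log_le_log (by positivity) (s.size_mul_le hδ0 hδ1 h0 h1)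
    rw [hδ, Real.log_mul (Real.exp_pos _).ne' (by positivity), Real.log_exp] at h3
    nlinarith
  calc (N₁ ε d : ℝ) ≤ C * (N₂ (δ * ε) d : ℝ) ^ r := by simpa using hN d ε h0 h1
    _ ≤ C * (C₂ * Real.exp (t * (1 + Real.log d) * (r * (1 + Real.log (s.size ε))))) ^ r := by
        gcongr
        refine (h d _ (by positivity) hδε).trans ?_
        gcongr
    _ = _ := by
        rw [Real.mul_rpow (by positivity) (by positivity), ← Real.exp_mul, NNReal.coe_mul, ← hr2]
        ring_nf

lemma QPT.of_dominated (h : QPT s N₂) (hN : Dominated N₁ N₂) : QPT s N₁ := by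
  obtain ⟨p, h⟩ := h
  exact ⟨_, h.of_dominated hN one_lt_two⟩

lemma qptExponent_le_of_dominated (hN : Dominated N₁ N₂) : qptExponent s N₁ ≤ qptExponent s N₂ :=
  ennreal_iInf_le_of_forall_mul fun _ hp _ hκ => QPTBound.of_dominated hp hN hκ

lemma Scale.size_tendsto_atTop (s : Scale) {α β : ℝ} (hα : 0 < α) (hβ : 0 < β) :
    Tendsto (fun x : ℝ × ℕ+ => s.size x.1 ^ α + (x.2 : ℝ) ^ β) limitFilter atTop := by
  rw [tendsto_atTop]
  intro B
  have h1 : ∀ᶠ y : ℝ in atTop, B ≤ s.size y⁻¹ ^ α := by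
    have h2 : Tendsto (fun y : ℝ => s.size y⁻¹) atTop atTop := by
      cases s
      · simpa [Scale.size] using! tendsto_id
      · simpa [Scale.size] using tendsto_atTop_add_const_left _ 1 Real.tendsto_log_atTop
    exact ((tendsto_rpow_atTop hα).comp h2).eventually_ge_atTop B
  have h2 : ∀ᶠ y : ℝ in atTop, B ≤ y ^ β := (tendsto_rpow_atTop hβ).eventually_ge_atTop B
  obtain ⟨K, hK⟩ := eventually_atTop.1 (h1.and h2)
  -- If the sum exceeds `2 * K`, one of `ε⁻¹` and `d` is at least `K`, and either alone makes its
  -- term large.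
  have h3 : ∀ᶠ x : ℝ × ℕ+ in limitFilter, K + K < x.1⁻¹ + (x.2 : ℝ) :=
    (tendsto_comap.mono_left inf_le_left).eventually_gt_atTop _
  have h4 : ∀ᶠ x : ℝ × ℕ+ in limitFilter, 0 < x.1 ∧ x.1 < 1 :=
    mem_inf_of_right (mem_principal_self _)
  filter_upwards [h3, h4] with x hx hx'
  have hT := s.one_le_size hx'.1 hx'.2
  have hp1 : 0 ≤ s.size x.1 ^ α := by positivity
  have hp2 : 0 ≤ (x.2 : ℝ) ^ β := by positivity
  rcases le_or_gt K x.1⁻¹ with h | h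
  · have := (hK _ h).1
    rw [inv_inv] at this
    linarith
  · have := (hK (x.2 : ℝ) (by linarith)).2
    linarith

lemma limitFilter_tendsto_mul {δ : ℝ} (hδ0 : 0 < δ) (hδ1 : δ < 1) :
    Tendsto (fun x : ℝ × ℕ+ => (δ * x.1, x.2)) limitFilter limitFilter := by
  have h4 : ∀ᶠ x : ℝ × ℕ+ in limitFilter, 0 < x.1 ∧ x.1 < 1 :=
    mem_inf_of_right (mem_principal_self _)
  refine tendsto_inf.2 ⟨tendsto_comap_iff.2 ?_, tendsto_principal.2 ?_⟩
  · have h : Tendsto (fun x : ℝ × ℕ+ => x.1⁻¹ + (x.2 : ℝ)) limitFilter atTop :=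
      tendsto_comap.mono_left inf_le_left
    refine tendsto_atTop_mono' _ ?_ h
    filter_upwards [h4] with x hx
    simp only [Function.comp]
    gcongr
    · exact mul_pos hδ0 hx.1
    · nlinarith [hx.1]
  · filter_upwards [h4] with x hx
    exact ⟨mul_pos hδ0 hx.1, by nlinarith [hx.1, hx.2]⟩

/-- After taking logarithms the constant becomes an additive term, negligible against the diverging
denominator, and the power becomes a factor. Halving `ε` changes the denominator by a bounded
factor, so crude values of `δ` and `η` suffice. -/
lemma STWT.of_dominated {α β : ℝ} (hα : 0 < α) (hβ : 0 < β) (h : STWT s N₂ α β)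
    (hN : Dominated N₁ N₂) : STWT s N₁ α β := by
  obtain ⟨C, hC, hN⟩ := hN (1 / 2) 1 (by norm_num) (by norm_num) one_pos
  have h4 : ∀ᶠ x : ℝ × ℕ+ in limitFilter, 0 < x.1 ∧ x.1 < 1 :=
    mem_inf_of_right (mem_principal_self _)
  have hσ : 1 ≤ s.size (1 / 2) := s.one_le_size (by norm_num) (by norm_num)
  have hA := s.size_tendsto_atTop hα hβ
  have hlim : Tendsto (fun x : ℝ × ℕ+ => |Real.log C| / (s.size x.1 ^ α + (x.2 : ℝ) ^ β) +
      2 * s.size (1 / 2) ^ α * (Real.log (N₂ (1 / 2 * x.1) x.2) /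
        (s.size (1 / 2 * x.1) ^ α + (x.2 : ℝ) ^ β))) limitFilter (𝓝 0) := by
    have h5 := h.comp (limitFilter_tendsto_mul (δ := 1 / 2) (by norm_num) (by norm_num))
    simpa using (hA.const_div_atTop |Real.log C|).add
      (h5.const_mul (2 * s.size (1 / 2) ^ α))
  refine squeeze_zero' ?_ ?_ hlim
  · filter_upwards [h4] with x hx
    have := s.one_le_size hx.1 hx.2
    have := Real.log_natCast_nonneg (N₁ x.1 x.2)
    positivity
  · filter_upwards [h4] with x hx
    have hT := s.one_le_size hx.1 hx.2
    have hT' : 1 ≤ s.size (1 / 2 * x.1) :=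
      s.one_le_size (by linarith [hx.1]) (by linarith [hx.2])
    have hl := Real.log_natCast_nonneg (N₁ x.1 x.2)
    have hl2 := Real.log_natCast_nonneg (N₂ (1 / 2 * x.1) x.2)
    have hd : (0 : ℝ) < (x.2 : ℝ) := by exact_mod_cast x.2.pos
    have hlog : Real.log (N₁ x.1 x.2) ≤
        |Real.log C| + 2 * Real.log (N₂ (1 / 2 * x.1) x.2) := by
      have hb := hN x.2 x.1 hx.1 hx.2
      -- Monotonicity of the logarithm needs positive arguments; `N₁ = 0` is covered by `log 0 = 0`,
      -- and otherwise the domination forces `N₂` to be positive.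
      rcases Nat.eq_zero_or_pos (N₁ x.1 x.2) with h0 | h0
      · simp only [h0, Nat.cast_zero, Real.log_zero]; positivity
      · have h02 : N₂ (1 / 2 * x.1) x.2 ≠ 0 := by
          intro h02
          rw [h02, Nat.cast_zero, Real.zero_rpow (by norm_num), mul_zero] at hb
          exact absurd hb (not_le.2 (by exact_mod_cast h0))
        have h02' : (0 : ℝ) < N₂ (1 / 2 * x.1) x.2 := by exact_mod_cast Nat.pos_of_ne_zero h02
        have := Real.log_le_log (by exact_mod_cast h0) hb
        rw [Real.log_mul hC.ne' (by positivity), Real.log_rpow h02'] at this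
        linarith [le_abs_self (Real.log C)]
    have hden : s.size (1 / 2 * x.1) ^ α + (x.2 : ℝ) ^ β ≤
        s.size (1 / 2) ^ α * (s.size x.1 ^ α + (x.2 : ℝ) ^ β) := by
      rw [mul_add]
      have h1 : 1 ≤ s.size (1 / 2) ^ α := Real.one_le_rpow hσ hα.le
      have h2 : s.size (1 / 2 * x.1) ^ α ≤ s.size (1 / 2) ^ α * s.size x.1 ^ α := by
        rw [← Real.mul_rpow (by positivity) (by positivity)]
        gcongr
        exact s.size_mul_le (by norm_num) (by norm_num) hx.1 hx.2
      have h3 : 0 ≤ (x.2 : ℝ) ^ β := by positivity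
      nlinarith
    have hpos : 0 < s.size x.1 ^ α + (x.2 : ℝ) ^ β := by positivity
    have hpos' : 0 < s.size (1 / 2 * x.1) ^ α + (x.2 : ℝ) ^ β := by positivity
    have hkey : Real.log (N₂ (1 / 2 * x.1) x.2) / (s.size x.1 ^ α + (x.2 : ℝ) ^ β) ≤
        s.size (1 / 2) ^ α * (Real.log (N₂ (1 / 2 * x.1) x.2) /
          (s.size (1 / 2 * x.1) ^ α + (x.2 : ℝ) ^ β)) := by
      rw [mul_div_assoc', div_le_div_iff₀ hpos hpos']
      nlinarith
    calc _ ≤ (|Real.log C| + 2 * Real.log (N₂ (1 / 2 * x.1) x.2)) /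
          (s.size x.1 ^ α + (x.2 : ℝ) ^ β) := by gcongr
      _ ≤ _ := by
        rw [add_div, mul_div_assoc, mul_assoc]
        gcongr

lemma wt_iff_stwt_one {N : ℝ → ℕ+ → ℕ} : WT s N ↔ STWT s N 1 1 := by
  simp [WT, STWT]

lemma WT.of_dominated (h : WT s N₂) (hN : Dominated N₁ N₂) : WT s N₁ :=
  wt_iff_stwt_one.2 ((wt_iff_stwt_one.1 h).of_dominated one_pos one_pos hN)

lemma UWT.of_dominated (h : UWT s N₂) (hN : Dominated N₁ N₂) : UWT s N₁ :=
  fun α β hα hβ => (h α β hα hβ).of_dominated hα hβ hN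

/-- Complexities that dominate each other in a cycle share a property that is inherited by
dominated complexities. -/
lemma tfae_of_dominated {N₃ : ℝ → ℕ+ → ℕ} {Q : (ℝ → ℕ+ → ℕ) → Prop}
    (hQ : ∀ N N', Q N' → Dominated N N' → Q N) (h₁₂ : Dominated N₁ N₂) (h₂₃ : Dominated N₂ N₃)
    (h₃₁ : Dominated N₃ N₁) : [Q N₁, Q N₂, Q N₃].TFAE := by
  tfae_have 2 → 1 := fun h => hQ _ _ h h₁₂
  tfae_have 3 → 2 := fun h => hQ _ _ h h₂₃
  tfae_have 1 → 3 := fun h => hQ _ _ h h₃₁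
  tfae_finish

end Comparison

end Transfer

/-! ### Randomized linear sampling and iterated refinement -/

section LinearSampling

section Sampling

/-- Pythagoras: the first term is unavoidable for approximations from the span, so only the error of
the coefficients is left to control. -/
lemma enorm_sub_sum_smul_sq {𝕜 H : Type*} [RCLike 𝕜] [NormedAddCommGroup H]
    [InnerProductSpace 𝕜 H] {n : ℕ} {e : Fin n → H} (he : Orthonormal 𝕜 e) (f : H)
    (c : Fin n → 𝕜) :
    ‖f - ∑ j, c j • e j‖ₑ ^ 2 =
      ‖f - ∑ j, inner 𝕜 (e j) f • e j‖ₑ ^ 2 + ∑ j, ‖c j - inner 𝕜 (e j) f‖ₑ ^ 2 := by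
  have key : ‖f - ∑ j, c j • e j‖ ^ 2 =
      ‖f - ∑ j, inner 𝕜 (e j) f • e j‖ ^ 2 + ∑ j, ‖c j - inner 𝕜 (e j) f‖ ^ 2 := by
    have h1 : f - ∑ j, c j • e j = (f - ∑ j, inner 𝕜 (e j) f • e j) +
        -∑ j, (c j - inner 𝕜 (e j) f) • e j := by
      simp only [sub_smul, Finset.sum_sub_distrib]
      abel
    have h2 : inner 𝕜 (f - ∑ j, inner 𝕜 (e j) f • e j)
        (-∑ j, (c j - inner 𝕜 (e j) f) • e j) = 0 := by
      rw [inner_neg_right, inner_sum, neg_eq_zero]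
      refine Finset.sum_eq_zero fun j _ => ?_
      rw [inner_smul_right, inner_sub_left, sum_inner]
      simp [inner_smul_left, orthonormal_iff_ite.1 he]
    have h3 : ‖∑ j, (c j - inner 𝕜 (e j) f) • e j‖ ^ 2 = ∑ j, ‖c j - inner 𝕜 (e j) f‖ ^ 2 := by
      have := he.inner_sum (fun j => c j - inner 𝕜 (e j) f) (fun j => c j - inner 𝕜 (e j) f)
        Finset.univ
      rw [inner_self_eq_norm_sq_to_K] at this
      simp_rw [RCLike.conj_mul] at this
      exact_mod_cast this
    rw [h1, sq, norm_add_sq_eq_norm_sq_add_norm_sq_of_inner_eq_zero _ _ h2, ← sq, ← sq, norm_neg,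
      h3]
  simp only [← ofReal_norm, ← ENNReal.ofReal_pow (norm_nonneg _)]
  rw [key, ENNReal.ofReal_add (by positivity) (by positivity),
    ENNReal.ofReal_sum_of_nonneg fun _ _ => by positivity]

variable {𝕜 : Type*} [RCLike 𝕜] {X : Type} [MeasurableSpace X]

variable (𝕜) in
/-- A linear randomized algorithm that approximates the `n` coefficients of a function with respect
to some system by linear combinations of values of the function at random points. -/
structure LinearSampling (μ : Measure X) (n : ℕ) where
  Ω : Type
  [measurableSpace : MeasurableSpace Ω]
  ℙ : Measure Ω
  [isProbabilityMeasure : IsProbabilityMeasure ℙ]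
  ι : Type
  [fintype : Fintype ι]
  x : ι → Ω → X
  quasiMeasurePreserving_x : ∀ i, Measure.QuasiMeasurePreserving (x i) ℙ μ
  a : ι → Fin n → Ω → 𝕜
  measurable_a : ∀ i j, Measurable (a i j)

attribute [instance] LinearSampling.measurableSpace LinearSampling.isProbabilityMeasure
  LinearSampling.fintype

namespace LinearSampling

variable {μ : Measure X} {n : ℕ} (Q : LinearSampling 𝕜 μ n)

/-- The computed coefficients. -/
def coef (h : X → 𝕜) (ω : Q.Ω) (j : Fin n) : 𝕜 := ∑ i, Q.a i j ω * h (Q.x i ω)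

lemma measurable_coef {h : X → 𝕜} (hh : Measurable h) (j : Fin n) :
    Measurable fun ω => Q.coef h ω j :=
  Finset.measurable_sum _ fun i _ =>
    (Q.measurable_a i j).mul (hh.comp (Q.quasiMeasurePreserving_x i).measurable)

/-- Each node map pulls null sets back to null sets. Sampling is therefore meaningful for `L₂`
classes although it uses point values. -/
lemma coef_congr_ae {h h' : X → 𝕜} (hh : h =ᵐ[μ] h') :
    ∀ᵐ ω ∂Q.ℙ, ∀ j, Q.coef h ω j = Q.coef h' ω j := by
  have h1 : ∀ᵐ ω ∂Q.ℙ, ∀ i, h (Q.x i ω) = h' (Q.x i ω) :=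
    ae_all_iff.2 fun i => (Q.quasiMeasurePreserving_x i).ae_eq_comp hh
  filter_upwards [h1] with ω hω j
  simp [coef, hω]

/-- The mean square error of the computed coefficients with respect to `e`. -/
def sqError (e : Fin n → Lp 𝕜 2 μ) (f : Lp 𝕜 2 μ) : ℝ≥0∞ :=
  ∫⁻ ω, ∑ j, ‖Q.coef f ω j - inner 𝕜 (e j) f‖ₑ ^ 2 ∂Q.ℙ

/-- Apply `Q`, then apply `R` to the residual. -/
def refine (e : Fin n → Lp 𝕜 2 μ) (R : LinearSampling 𝕜 μ n) : LinearSampling 𝕜 μ n where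
  Ω := Q.Ω × R.Ω
  ℙ := Q.ℙ.prod R.ℙ
  ι := Q.ι ⊕ R.ι
  x := Sum.elim (fun i ω => Q.x i ω.1) (fun i ω => R.x i ω.2)
  quasiMeasurePreserving_x := by
    rintro (i | i)
    · exact (Q.quasiMeasurePreserving_x i).comp Measure.quasiMeasurePreserving_fst
    · exact (R.quasiMeasurePreserving_x i).comp Measure.quasiMeasurePreserving_snd
  a := Sum.elim
    (fun i j ω => Q.a i j ω.1 - ∑ k, R.coef (e k) ω.2 j * Q.a i k ω.1)
    (fun i j ω => R.a i j ω.2)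
  measurable_a := by
    rintro (i | i) j
    · refine ((Q.measurable_a i j).comp measurable_fst).sub
        (Finset.measurable_sum _ fun k _ => ?_)
      exact ((R.measurable_coef (Lp.stronglyMeasurable (e k)).measurable j).comp
        measurable_snd).mul ((Q.measurable_a i k).comp measurable_fst)
    · exact (R.measurable_a i j).comp measurable_snd

/-- The `e k` are known functions, so values of the residual need only values of `h` itself, at the
nodes of `Q` and `R`. Thus the two-step method is again linear sampling, with corrected weights at
the nodes of `Q`. -/
lemma coef_refine (e : Fin n → Lp 𝕜 2 μ) (R : LinearSampling 𝕜 μ n) (h : X → 𝕜)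
    (ω : Q.Ω × R.Ω) (j : Fin n) :
    (Q.refine e R).coef h ω j =
      Q.coef h ω.1 j + R.coef (fun x => h x - ∑ k, Q.coef h ω.1 k * e k x) ω.2 j := by
  have h1 : R.coef (fun x => h x - ∑ k, Q.coef h ω.1 k * e k x) ω.2 j =
      R.coef h ω.2 j - ∑ k, Q.coef h ω.1 k * R.coef (e k) ω.2 j := by
    simp only [coef, mul_sub, Finset.sum_sub_distrib, Finset.mul_sum, Finset.sum_mul]
    congr 1
    rw [Finset.sum_comm]
    exact Finset.sum_congr rfl fun k _ => Finset.sum_congr rfl fun i _ =>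
      Finset.sum_congr rfl fun l _ => by ring
  have h2 : (Q.refine e R).coef h ω j =
      ∑ i, (Q.a i j ω.1 - ∑ k, R.coef (e k) ω.2 j * Q.a i k ω.1) * h (Q.x i ω.1) +
        R.coef h ω.2 j :=
    Fintype.sum_sum_type _
  have h3 : ∑ i, (Q.a i j ω.1 - ∑ k, R.coef (e k) ω.2 j * Q.a i k ω.1) * h (Q.x i ω.1) =
      Q.coef h ω.1 j - ∑ k, Q.coef h ω.1 k * R.coef (e k) ω.2 j := by
    simp only [sub_mul, Finset.sum_sub_distrib, Finset.sum_mul]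
    congr 1
    rw [Finset.sum_comm]
    refine Finset.sum_congr rfl fun k _ => ?_
    change _ = (∑ i, Q.a i k ω.1 * h (Q.x i ω.1)) * _
    rw [Finset.sum_mul]
    exact Finset.sum_congr rfl fun i _ => by ring
  rw [h2, h3, h1]
  ring

/-- For a fixed outcome of `Q` the new coefficient error is the error of `R` on the residual,
because the coefficients of the residual are exactly the errors left by `Q`. Pythagoras evaluates
the norm of the residual, and independence permits integrating in turn. -/
lemma sqError_refine_le {e : Fin n → Lp 𝕜 2 μ} (he : Orthonormal 𝕜 e)
    (R : LinearSampling 𝕜 μ n) {q : ℝ≥0∞} (hR : ∀ f, R.sqError e f ≤ q * ‖f‖ₑ ^ 2)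
    (f : Lp 𝕜 2 μ) :
    (Q.refine e R).sqError e f ≤
      q * (‖f - ∑ j, inner 𝕜 (e j) f • e j‖ₑ ^ 2 + Q.sqError e f) := by
  have hf := (Lp.stronglyMeasurable f).measurable
  have hm : Measurable fun ω : (Q.refine e R).Ω =>
      ∑ j, ‖(Q.refine e R).coef f ω j - inner 𝕜 (e j) f‖ₑ ^ 2 :=
    Finset.measurable_sum _ fun j _ =>
      (((Q.refine e R).measurable_coef hf j).sub_const _).enorm.pow_const 2
  have hmQ : Measurable fun ω : Q.Ω => ∑ j, ‖Q.coef f ω j - inner 𝕜 (e j) f‖ₑ ^ 2 :=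
    Finset.measurable_sum _ fun j _ => ((Q.measurable_coef hf j).sub_const _).enorm.pow_const 2
  calc (Q.refine e R).sqError e f
      = ∫⁻ ω₁ : Q.Ω, (∫⁻ ω₂ : R.Ω, (∑ j, ‖(Q.refine e R).coef f (ω₁, ω₂) j -
          inner 𝕜 (e j) f‖ₑ ^ 2) ∂(R.ℙ)) ∂Q.ℙ := lintegral_prod _ hm.aemeasurable
    _ ≤ ∫⁻ ω₁, q * (‖f - ∑ j, inner 𝕜 (e j) f • e j‖ₑ ^ 2 +
          ∑ j, ‖Q.coef f ω₁ j - inner 𝕜 (e j) f‖ₑ ^ 2) ∂Q.ℙ := by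
        refine lintegral_mono fun ω₁ => ?_
        let r : Lp 𝕜 2 μ := f - ∑ j, Q.coef f ω₁ j • e j
        have hr : (r : X → 𝕜) =ᵐ[μ] fun x => f x - ∑ k, Q.coef f ω₁ k * e k x := by
          have h1 : ∀ᵐ x ∂μ, ∀ k, (Q.coef f ω₁ k • e k : Lp 𝕜 2 μ) x = Q.coef f ω₁ k * e k x :=
            ae_all_iff.2 fun k => Lp.coeFn_smul (Q.coef f ω₁ k) (e k)
          filter_upwards [h1, Lp.coeFn_sub f (∑ j, Q.coef f ω₁ j • e j),
            Lp.coeFn_finsetSum Finset.univ fun j => Q.coef f ω₁ j • e j] with x hx1 hx2 hx3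
          simp only [r, hx2, Pi.sub_apply, hx3, Finset.sum_apply, hx1]
        have hinner : ∀ j, inner 𝕜 (e j) r = inner 𝕜 (e j) f - Q.coef f ω₁ j := by
          intro j
          simp only [r, inner_sub_right, inner_sum, inner_smul_right]
          simp [orthonormal_iff_ite.1 he]
        calc _ = R.sqError e r := by
              refine lintegral_congr_ae ?_
              filter_upwards [R.coef_congr_ae hr] with ω₂ hω
              refine Finset.sum_congr rfl fun j _ => ?_
              rw [coef_refine, hω, hinner]
              congr 2
              ring
          _ ≤ q * ‖r‖ₑ ^ 2 := hR r
          _ = _ := by rw [enorm_sub_sum_smul_sq he]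
    _ = _ := by
        rw [lintegral_const_mul _ (by fun_prop), lintegral_add_left measurable_const,
          lintegral_const, measure_univ, mul_one]
        rfl

/-- `l` refinement steps. -/
def iterate (e : Fin n → Lp 𝕜 2 μ) (R : LinearSampling 𝕜 μ n) : ℕ → LinearSampling 𝕜 μ n
  | 0 => Q
  | l + 1 => (iterate e R l).refine e R

lemma card_iterate (e : Fin n → Lp 𝕜 2 μ) (R : LinearSampling 𝕜 μ n) (l : ℕ) :
    Fintype.card (Q.iterate e R l).ι = Fintype.card Q.ι + l * Fintype.card R.ι := by
  induction l with
  | zero => rw [zero_mul, add_zero]; rfl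
  | succ l ih =>
    have : Fintype.card (Q.iterate e R (l + 1)).ι =
      Fintype.card (Q.iterate e R l).ι + Fintype.card R.ι := Fintype.card_sum
    rw [this, ih]
    ring

/-- The recursion `E ↦ q * (G + E)` contracts by `q`; under `2 * q ≤ 1` its fixed point lies below
`2 * q * G`, and the initial factor `M` decays like `q ^ l`. -/
lemma sqError_iterate_le {e : Fin n → Lp 𝕜 2 μ} (he : Orthonormal 𝕜 e)
    (R : LinearSampling 𝕜 μ n) {q M : ℝ≥0∞} (hq : 2 * q ≤ 1)
    (hR : ∀ f, R.sqError e f ≤ q * ‖f‖ₑ ^ 2)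
    (hQ : ∀ f, Q.sqError e f ≤ M * ‖f - ∑ j, inner 𝕜 (e j) f • e j‖ₑ ^ 2) (l : ℕ)
    (f : Lp 𝕜 2 μ) :
    (Q.iterate e R l).sqError e f ≤
      (2 * q + q ^ l * M) * ‖f - ∑ j, inner 𝕜 (e j) f • e j‖ₑ ^ 2 := by
  induction l with
  | zero =>
    refine (hQ f).trans ?_
    gcongr
    simp
  | succ l ih =>
    refine (sqError_refine_le _ he R hR f).trans ?_
    set G := ‖f - ∑ j, inner 𝕜 (e j) f • e j‖ₑ ^ 2
    calc _ ≤ q * (G + (2 * q + q ^ l * M) * G) := by gcongr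
      _ = (q + q * (2 * q) + q ^ (l + 1) * M) * G := by ring
      _ ≤ (q + q * 1 + q ^ (l + 1) * M) * G := by gcongr
      _ = _ := by ring

end LinearSampling

end Sampling

end LinearSampling

/-! ### Monte Carlo estimation of coefficients by importance sampling -/

section MonteCarlo

section MonteCarlo

variable {𝕜 : Type*} [RCLike 𝕜] {X : Type*} [MeasurableSpace X]

lemma lintegral_enorm_sq_eq {μ : Measure X} (h : X → 𝕜) :
    ∫⁻ x, ‖h x‖ₑ ^ 2 ∂μ = eLpNorm h 2 μ ^ 2 := by
  have := eLpNorm_nnreal_pow_eq_lintegral (f := h) (μ := μ) (p := 2) (by norm_num)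
  simp only [ENNReal.coe_ofNat, NNReal.coe_ofNat, ENNReal.rpow_ofNat] at this
  exact this.symm

lemma enorm_toLp_sq {μ : Measure X} {h : X → 𝕜} (hh : MemLp h 2 μ) :
    ‖hh.toLp h‖ₑ ^ 2 = ∫⁻ x, ‖h x‖ₑ ^ 2 ∂μ := by
  rw [Lp.enorm_toLp, lintegral_enorm_sq_eq]

lemma enorm_Lp_sq {μ : Measure X} (f : Lp 𝕜 2 μ) : ‖f‖ₑ ^ 2 = ∫⁻ x, ‖f x‖ₑ ^ 2 ∂μ := by
  rw [Lp.enorm_def, lintegral_enorm_sq_eq]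

/-- The sum of pairwise orthogonal vectors of the same size. -/
lemma enorm_sum_sq_of_pairwise_inner_eq_zero {H ι : Type*} [NormedAddCommGroup H]
    [InnerProductSpace 𝕜 H] [Fintype ι] {z : ι → H}
    (hz : Pairwise fun i j => inner 𝕜 (z i) (z j) = 0) :
    ‖∑ i, z i‖ₑ ^ 2 = ∑ i, ‖z i‖ₑ ^ 2 := by
  classical
  have key : ‖∑ i, z i‖ ^ 2 = ∑ i, ‖z i‖ ^ 2 := by
    have h1 : (inner 𝕜 (∑ i, z i) (∑ i, z i)) = ∑ i, inner 𝕜 (z i) (z i) := by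
      rw [sum_inner]
      refine Finset.sum_congr rfl fun i _ => ?_
      rw [inner_sum]
      exact Finset.sum_eq_single i (fun j _ hj => hz hj.symm) (by simp)
    simp_rw [inner_self_eq_norm_sq_to_K] at h1
    exact_mod_cast h1
  simp only [← ofReal_norm, ← ENNReal.ofReal_pow (norm_nonneg _)]
  rw [key, ENNReal.ofReal_sum_of_nonneg fun _ _ => by positivity]

lemma lintegral_enorm_sub_integral_sq_le {ν : Measure X} [IsProbabilityMeasure ν] {Y : X → 𝕜}
    (hY : MemLp Y 2 ν) :
    ∫⁻ x, ‖Y x - ∫ y, Y y ∂ν‖ₑ ^ 2 ∂ν ≤ ∫⁻ x, ‖Y x‖ₑ ^ 2 ∂ν := by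
  set β := ∫ y, Y y ∂ν
  have hβ : MemLp (fun _ : X => β) 2 ν := memLp_const β
  have hZ : MemLp (fun x => Y x - β) 2 ν := hY.sub hβ
  have horth : inner 𝕜 (hZ.toLp _) (hβ.toLp _) = 0 := by
    have hint := hY.integrable (by norm_num)
    rw [← inner_conj_symm, L2.inner_def]
    have : ∫ x, inner 𝕜 (hβ.toLp _ x) (hZ.toLp _ x) ∂ν =
        ∫ x, (starRingEnd 𝕜 β) * (Y x - β) ∂ν := by
      refine integral_congr_ae ?_
      filter_upwards [hβ.coeFn_toLp, hZ.coeFn_toLp] with x h1 h2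
      rw [h1, h2, RCLike.inner_apply, mul_comm]
    rw [this, integral_const_mul, integral_sub hint (integrable_const _)]
    simp [β]
  have hsum : hY.toLp Y = hZ.toLp _ + hβ.toLp _ := by
    rw [← MemLp.toLp_add]
    congr 1
    ext x
    simp
  rw [← enorm_toLp_sq hY, ← enorm_toLp_sq hZ, hsum]
  have := norm_add_sq_eq_norm_sq_add_norm_sq_of_inner_eq_zero _ _ horth
  simp only [← ofReal_norm, ← ENNReal.ofReal_pow (norm_nonneg _)]
  refine ENNReal.ofReal_le_ofReal ?_
  nlinarith [norm_nonneg (hβ.toLp (fun _ : X => β))]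

/-- The mean square error of the empirical mean of `m` independent copies. -/
lemma lintegral_enorm_mean_sub_integral_sq_le {ν : Measure X} [IsProbabilityMeasure ν] {Y : X → 𝕜}
    (hYm : Measurable Y) (hY : MemLp Y 2 ν) {m : ℕ} (hm : m ≠ 0) :
    ∫⁻ x : Fin m → X, ‖∑ i, (m : 𝕜)⁻¹ * Y (x i) - ∫ y, Y y ∂ν‖ₑ ^ 2
      ∂(Measure.pi fun _ => ν) ≤ (m : ℝ≥0∞)⁻¹ * ∫⁻ x, ‖Y x‖ₑ ^ 2 ∂ν := by
  set β := ∫ y, Y y ∂ν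
  let Z : X → 𝕜 := fun x => Y x - β
  have hZm : Measurable Z := hYm.sub_const _
  have hZ : MemLp Z 2 ν := hY.sub (memLp_const β)
  have hZ0 : ∫ x, Z x ∂ν = 0 := by
    simp only [Z]
    rw [integral_sub (hY.integrable (by norm_num)) (integrable_const _)]
    simp [β]
  let ℙ : Measure (Fin m → X) := Measure.pi fun _ => ν
  have hev : ∀ i, MeasurePreserving (fun x : Fin m → X => x i) ℙ ν :=
    fun i => measurePreserving_eval _ i
  have hz : ∀ i, MemLp (fun x : Fin m → X => Z (x i)) 2 ℙ :=
    fun i => hZ.comp_measurePreserving (hev i)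
  -- Independent centred copies are orthogonal in `L₂`, so their squared norms add; this produces
  -- the factor `1 / m`.
  have horth : Pairwise fun i j => inner 𝕜 ((hz i).toLp _) ((hz j).toLp _) = 0 := by
    intro i j hij
    rw [L2.inner_def]
    have h1 : ∫ x, inner 𝕜 ((hz i).toLp _ x) ((hz j).toLp _ x) ∂ℙ =
        ∫ x, Z (x j) * (starRingEnd 𝕜 (Z (x i))) ∂ℙ := by
      refine integral_congr_ae ?_
      filter_upwards [(hz i).coeFn_toLp, (hz j).coeFn_toLp] with x h1 h2
      rw [h1, h2, RCLike.inner_apply]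
    have hind : ProbabilityTheory.iIndepFun (fun i (x : Fin m → X) => x i) ℙ :=
      ProbabilityTheory.iIndepFun_pi (X := fun _ x => x) fun i => aemeasurable_id
    have h2 := (hind.indepFun hij.symm).integral_fun_comp_mul_comp (f := Z)
      (g := fun x => starRingEnd 𝕜 (Z x)) (measurable_pi_apply j).aemeasurable
      (measurable_pi_apply i).aemeasurable hZm.aestronglyMeasurable
      (RCLike.continuous_conj.measurable.comp hZm).aestronglyMeasurable
    have h3 : ∫ x : Fin m → X, Z (x j) ∂ℙ = ∫ x, Z x ∂ν := by
      rw [← (hev j).map_eq, integral_map (hev j).measurable.aemeasurable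
        hZm.aestronglyMeasurable]
    rw [h1, h2, h3, hZ0, zero_mul]
  have hmean : ∀ x : Fin m → X, ∑ i, (m : 𝕜)⁻¹ * Y (x i) - β = (m : 𝕜)⁻¹ * ∑ i, Z (x i) := by
    intro x
    have hm' : (m : 𝕜) ≠ 0 := Nat.cast_ne_zero.2 hm
    simp only [Z, Finset.sum_sub_distrib, ← Finset.mul_sum]
    rw [Finset.sum_const, Finset.card_univ, Fintype.card_fin, nsmul_eq_mul]
    field_simp
  have hsum : ∫⁻ x, ‖∑ i, Z (x i)‖ₑ ^ 2 ∂ℙ = ∑ i, ∫⁻ x, ‖Z (x i)‖ₑ ^ 2 ∂ℙ := by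
    have h1 := enorm_sum_sq_of_pairwise_inner_eq_zero horth
    simp_rw [enorm_toLp_sq] at h1
    rw [← h1, enorm_Lp_sq]
    refine lintegral_congr_ae ?_
    have h2 : ∀ᵐ x ∂ℙ, ∀ i, (hz i).toLp _ x = Z (x i) := ae_all_iff.2 fun i => (hz i).coeFn_toLp
    filter_upwards [Lp.coeFn_finsetSum Finset.univ fun i => (hz i).toLp _, h2] with x hx hx2
    rw [hx, Finset.sum_apply]
    simp_rw [hx2]
  have hone : ∀ i, ∫⁻ x, ‖Z (x i)‖ₑ ^ 2 ∂ℙ = ∫⁻ x, ‖Z x‖ₑ ^ 2 ∂ν := fun i =>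
    (hev i).lintegral_comp (f := fun x => ‖Z x‖ₑ ^ 2) (hZm.enorm.pow_const 2)
  have hconst : ‖(m : 𝕜)⁻¹‖ₑ = (m : ℝ≥0∞)⁻¹ := by
    rw [enorm_inv (Nat.cast_ne_zero.2 hm)]
    congr 1
    rw [← ofReal_norm]
    simp
  calc ∫⁻ x : Fin m → X, ‖∑ i, (m : 𝕜)⁻¹ * Y (x i) - β‖ₑ ^ 2 ∂ℙ
      = ∫⁻ x : Fin m → X, (m : ℝ≥0∞)⁻¹ ^ 2 * ‖∑ i, Z (x i)‖ₑ ^ 2 ∂ℙ := by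
        simp_rw [hmean, enorm_mul, mul_pow, hconst]
    _ = (m : ℝ≥0∞)⁻¹ ^ 2 * (m * ∫⁻ x, ‖Z x‖ₑ ^ 2 ∂ν) := by
        rw [lintegral_const_mul _ (by fun_prop), hsum]
        simp [hone]
    _ = (m : ℝ≥0∞)⁻¹ * ∫⁻ x, ‖Z x‖ₑ ^ 2 ∂ν := by
        rw [← mul_assoc, sq, mul_assoc (m : ℝ≥0∞)⁻¹, ENNReal.inv_mul_cancel
          (Nat.cast_ne_zero.2 hm) (ENNReal.natCast_ne_top m), mul_one]
    _ ≤ _ := by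
        exact mul_le_mul_right (lintegral_enorm_sub_integral_sq_le hY) _

end MonteCarlo

namespace LinearSampling

variable {𝕜 : Type*} [RCLike 𝕜] {X : Type} [MeasurableSpace X] {μ : Measure X} {n : ℕ}

/-- The density of the sampling distribution for the approximation of the coefficients with
respect to `e`. -/
def density (e : Fin n → Lp 𝕜 2 μ) (x : X) : ℝ≥0 := (∑ j, ‖e j x‖₊ ^ 2) / n

lemma measurable_density (e : Fin n → Lp 𝕜 2 μ) : Measurable (density e) :=
  (Finset.measurable_sum _ fun j _ =>
    (Lp.stronglyMeasurable (e j)).measurable.nnnorm.pow_const 2).div_const _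

lemma lintegral_density {e : Fin n → Lp 𝕜 2 μ} (he : Orthonormal 𝕜 e) (hn : n ≠ 0) :
    ∫⁻ x, density e x ∂μ = 1 := by
  have h0 : ∀ x, (density e x : ℝ≥0∞) = (n : ℝ≥0∞)⁻¹ * ∑ j, ‖e j x‖ₑ ^ 2 := by
    intro x
    rw [density, ENNReal.coe_div (Nat.cast_ne_zero.2 hn), ENNReal.div_eq_inv_mul]
    simp [enorm_eq_nnnorm]
  simp_rw [h0]
  rw [lintegral_const_mul _ (Finset.measurable_sum _ fun j _ =>
    (Lp.stronglyMeasurable (e j)).measurable.enorm.pow_const 2), lintegral_finsetSum _ fun j _ =>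
    (Lp.stronglyMeasurable (e j)).measurable.enorm.pow_const 2]
  simp_rw [← enorm_Lp_sq]
  have h1 : ∀ j, ‖e j‖ₑ = 1 := fun j => by rw [← ofReal_norm, he.1 j, ENNReal.ofReal_one]
  simp only [h1, one_pow, Finset.sum_const, Finset.card_univ, Fintype.card_fin, nsmul_eq_mul,
    mul_one]
  exact ENNReal.inv_mul_cancel (Nat.cast_ne_zero.2 hn) (ENNReal.natCast_ne_top n)

/-- The coefficients as empirical means of `m` independent importance samples. -/
def monteCarlo (e : Fin n → Lp 𝕜 2 μ) (he : Orthonormal 𝕜 e) (hn : n ≠ 0) (m : ℕ) :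
    LinearSampling 𝕜 μ n :=
  have : IsProbabilityMeasure (μ.withDensity fun x => (density e x : ℝ≥0∞)) :=
    ⟨by rw [withDensity_apply _ .univ, setLIntegral_univ, lintegral_density he hn]⟩
  { Ω := Fin m → X
    ℙ := Measure.pi fun _ => μ.withDensity fun x => (density e x : ℝ≥0∞)
    ι := Fin m
    x := fun i ω => ω i
    quasiMeasurePreserving_x := fun i =>
      (Measure.quasiMeasurePreserving_eval _ i).mono_right (withDensity_absolutelyContinuous _ _)
    a := fun i j ω => (m : 𝕜)⁻¹ * (((density e (ω i) : ℝ) : 𝕜)⁻¹ * starRingEnd 𝕜 (e j (ω i)))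
    measurable_a := fun i j => by
      have h1 : Measurable fun x => ((density e x : ℝ) : 𝕜)⁻¹ :=
        (RCLike.measurable_ofReal.comp (measurable_density e).coe_nnreal_real).inv
      have h2 : Measurable fun x => starRingEnd 𝕜 (e j x) :=
        RCLike.continuous_conj.measurable.comp (Lp.stronglyMeasurable (e j)).measurable
      exact ((h1.mul h2).comp (measurable_pi_apply i)).const_mul _ }

/-- The sampling density is chosen so that the squared sizes of all `n` weighted integrands `Y j`,
summed and multiplied by the density, give exactly `n * ‖f x‖²` wherever the density is nonzero. The
second moments then sum to at most `n * ‖f‖²` without any bound on the `e j`, and averaging divides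
by `m`. -/
lemma sqError_monteCarlo_le {e : Fin n → Lp 𝕜 2 μ} (he : Orthonormal 𝕜 e) (hn : n ≠ 0) {m : ℕ}
    (hm : m ≠ 0) (f : Lp 𝕜 2 μ) :
    (monteCarlo e he hn m).sqError e f ≤ (n : ℝ≥0∞) / m * ‖f‖ₑ ^ 2 := by
  have hν : IsProbabilityMeasure (μ.withDensity fun x => (density e x : ℝ≥0∞)) :=
    ⟨by rw [withDensity_apply _ .univ, setLIntegral_univ, lintegral_density he hn]⟩
  set ν := μ.withDensity fun x => (density e x : ℝ≥0∞)
  let Y : Fin n → X → 𝕜 := fun j x =>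
    ((density e x : ℝ) : 𝕜)⁻¹ * starRingEnd 𝕜 (e j x) * f x
  have hYm : ∀ j, Measurable (Y j) := fun j => by
    have h1 : Measurable fun x => ((density e x : ℝ) : 𝕜)⁻¹ :=
      (RCLike.measurable_ofReal.comp (measurable_density e).coe_nnreal_real).inv
    have h2 : Measurable fun x => starRingEnd 𝕜 (e j x) :=
      RCLike.continuous_conj.measurable.comp (Lp.stronglyMeasurable (e j)).measurable
    exact (h1.mul h2).mul (Lp.stronglyMeasurable f).measurable
  have hY2 : ∑ j, ∫⁻ x, ‖Y j x‖ₑ ^ 2 ∂ν ≤ n * ‖f‖ₑ ^ 2 := by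
    rw [← lintegral_finsetSum _ fun j _ => (hYm j).enorm.pow_const 2,
      lintegral_withDensity_eq_lintegral_mul _ (measurable_density e).coe_nnreal_ennreal
        (Finset.measurable_sum _ fun j _ => (hYm j).enorm.pow_const 2), enorm_Lp_sq,
      ← lintegral_const_mul _ ((Lp.stronglyMeasurable f).measurable.enorm.pow_const 2)]
    refine lintegral_mono fun x => ?_
    suffices h : density e x * ∑ j, ‖Y j x‖₊ ^ 2 ≤ n * ‖f x‖₊ ^ 2 by
      simp only [Pi.mul_apply, enorm_eq_nnnorm]
      exact_mod_cast h
    rcases eq_or_ne (density e x) 0 with h0 | h0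
    · simp [h0]
    · have hd : ∑ j, ‖e j x‖₊ ^ 2 = n * density e x := by
        rw [density, mul_div_cancel₀ _ (Nat.cast_ne_zero.2 hn)]
      have hd2 : ‖((density e x : ℝ) : 𝕜)⁻¹‖₊ = (density e x)⁻¹ := by
        rw [nnnorm_inv]
        congr 1
        ext
        simp
      simp only [Y, nnnorm_mul, mul_pow, hd2, ← Finset.sum_mul, ← Finset.mul_sum, RCLike.nnnorm_conj]
      rw [hd]
      field_simp
      exact le_rfl
  have hYL : ∀ j, MemLp (Y j) 2 ν := fun j => by
    refine ⟨(hYm j).aestronglyMeasurable, ?_⟩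
    have h1 : eLpNorm (Y j) 2 ν ^ 2 < ∞ := by
      rw [← lintegral_enorm_sq_eq]
      refine lt_of_le_of_lt (Finset.single_le_sum
        (f := fun j => ∫⁻ x, ‖Y j x‖ₑ ^ 2 ∂ν) (fun _ _ => zero_le) (Finset.mem_univ j))
        (hY2.trans_lt ?_)
      exact ENNReal.mul_lt_top (ENNReal.natCast_lt_top n) (ENNReal.pow_lt_top enorm_lt_top)
    exact (ENNReal.pow_lt_top_iff.1 h1).resolve_right (by norm_num)
  have hYint : ∀ j, ∫ x, Y j x ∂ν = inner 𝕜 (e j) f := fun j => by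
    rw [integral_withDensity_eq_integral_smul (measurable_density e), L2.inner_def]
    refine integral_congr_ae (Eventually.of_forall fun x => ?_)
    simp only [Y, RCLike.inner_apply, NNReal.smul_def, RCLike.real_smul_eq_coe_mul]
    -- Where the density vanishes every `e j` vanishes too, so no part of the inner product is lost
    -- and the value of `0⁻¹` is immaterial.
    rcases eq_or_ne (density e x) 0 with h0 | h0
    · have hj : e j x = 0 := by
        rw [density, div_eq_zero_iff, or_iff_left (Nat.cast_ne_zero.2 hn)] at h0
        have := (Finset.sum_eq_zero_iff.1 h0) j (Finset.mem_univ j)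
        simpa using this
      simp [hj]
    · have : ((density e x : ℝ) : 𝕜) ≠ 0 := by simpa using h0
      field_simp
  calc (monteCarlo e he hn m).sqError e f
      = ∫⁻ ω : Fin m → X, ∑ j, ‖∑ i, (m : 𝕜)⁻¹ * Y j (ω i) - ∫ x, Y j x ∂ν‖ₑ ^ 2
          ∂(Measure.pi fun _ => ν) := by
        simp_rw [hYint]
        simp only [sqError, coef, monteCarlo, Y, mul_assoc]
        rfl
    _ = ∑ j, ∫⁻ ω : Fin m → X, ‖∑ i, (m : 𝕜)⁻¹ * Y j (ω i) - ∫ x, Y j x ∂ν‖ₑ ^ 2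
          ∂(Measure.pi fun _ => ν) :=
        lintegral_finsetSum _ fun j _ => ((Finset.measurable_sum _ fun i _ =>
          ((hYm j).comp (measurable_pi_apply i)).const_mul _).sub_const _).enorm.pow_const 2
    _ ≤ ∑ j, (m : ℝ≥0∞)⁻¹ * ∫⁻ x, ‖Y j x‖ₑ ^ 2 ∂ν := by
        gcongr with j
        exact lintegral_enorm_mean_sub_integral_sq_le (hYm j) (hYL j) hm
    _ ≤ (m : ℝ≥0∞)⁻¹ * (n * ‖f‖ₑ ^ 2) := by
        rw [← Finset.mul_sum]
        gcongr
    _ = _ := by rw [← mul_assoc, ENNReal.div_eq_inv_mul]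

end LinearSampling

end MonteCarlo

/-! ### Interpolation at determinantal random nodes -/

section Interpolation

section Determinant

variable {𝕜 : Type*} [RCLike 𝕜] {X : Type*} [MeasurableSpace X] {μ : Measure X} {n : ℕ}

/-- The matrix `(φ_j(x_i))_{i,j}`. -/
def collocationMatrix (φ : Fin n → Lp 𝕜 2 μ) (x : Fin n → X) : Matrix (Fin n) (Fin n) 𝕜 :=
  Matrix.of fun i j => φ j (x i)

lemma measurable_det_collocationMatrix (φ : Fin n → Lp 𝕜 2 μ) :
    Measurable fun x => (collocationMatrix φ x).det := by
  simp_rw [Matrix.det_apply]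
  refine Finset.measurable_sum _ fun σ _ => Measurable.const_smul
    (Finset.measurable_prod _ fun i _ => ?_) _
  exact (Lp.stronglyMeasurable (φ i)).measurable.comp (measurable_pi_apply _)

variable [IsProbabilityMeasure μ]

/-- The second moment of the determinant of the collocation matrix of an orthogonal system at
independent random points. -/
lemma lintegral_enorm_det_collocationMatrix_sq {φ : Fin n → Lp 𝕜 2 μ}
    (hφ : Pairwise fun i j => inner 𝕜 (φ i) (φ j) = 0) :
    ∫⁻ x, ‖(collocationMatrix φ x).det‖ₑ ^ 2 ∂(Measure.pi fun _ => μ) =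
      n.factorial * ∏ i, ‖φ i‖ₑ ^ 2 := by
  let ℙ : Measure (Fin n → X) := Measure.pi fun _ => μ
  let h : Equiv.Perm (Fin n) → (Fin n → X) → 𝕜 := fun σ x =>
    ((σ.sign : ℤ) : 𝕜) * ∏ i, φ (σ i) (x i)
  have hsq : ∀ σ : Equiv.Perm (Fin n), ((σ.sign : ℤ) : 𝕜) * ((σ.sign : ℤ) : 𝕜) = 1 := by
    intro σ
    rcases Int.units_eq_one_or σ.sign with h | h <;> simp [h]
  have hsn : ∀ σ : Equiv.Perm (Fin n), ‖((σ.sign : ℤ) : 𝕜)‖ = 1 := by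
    intro σ
    rcases Int.units_eq_one_or σ.sign with h | h <;> simp [h]
  have hmem : ∀ σ, MemLp (h σ) 2 ℙ := by
    intro σ
    have hm : Measurable (h σ) := (Finset.measurable_prod _ fun i _ =>
      (Lp.stronglyMeasurable (φ (σ i))).measurable.comp (measurable_pi_apply _)).const_mul _
    rw [memLp_two_iff_integrable_sq_norm hm.aestronglyMeasurable]
    simp only [h, norm_mul, hsn, one_mul, norm_prod, ← Finset.prod_pow]
    exact Integrable.fintype_prod (f := fun i x => ‖φ (σ i) x‖ ^ 2) (μ := fun _ => μ)
      fun i => (Lp.memLp (φ (σ i))).integrable_norm_pow two_ne_zero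
  have hinner : ∀ σ τ, inner 𝕜 ((hmem σ).toLp _) ((hmem τ).toLp _) =
      ((τ.sign : ℤ) : 𝕜) * ((σ.sign : ℤ) : 𝕜) * ∏ i, inner 𝕜 (φ (σ i)) (φ (τ i)) := by
    intro σ τ
    rw [L2.inner_def]
    simp_rw [L2.inner_def]
    rw [← integral_fintype_prod_eq_prod (μ := fun _ => μ)
      (f := fun i x => inner 𝕜 (φ (σ i) x) (φ (τ i) x)), ← integral_const_mul]
    refine integral_congr_ae ?_
    filter_upwards [(hmem σ).coeFn_toLp, (hmem τ).coeFn_toLp] with x h1 h2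
    rw [h1, h2]
    simp only [h, RCLike.inner_apply, map_mul, map_prod, Finset.prod_mul_distrib, map_intCast]
    ring
  -- Distinct permutations differ at some index, where the factor of the product is an inner product
  -- of two different `φ`. The `n!` Leibniz terms are therefore orthogonal, and they all have the
  -- same norm.
  have horth : Pairwise fun σ τ => inner 𝕜 ((hmem σ).toLp _) ((hmem τ).toLp _) = 0 := by
    intro σ τ hστ
    obtain ⟨i, hi⟩ : ∃ i, σ i ≠ τ i := by
      by_contra! hc
      exact hστ (Equiv.ext hc)
    rw [hinner, Finset.prod_eq_zero (Finset.mem_univ i) (hφ hi), mul_zero]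
  have hnorm : ∀ σ, ‖(hmem σ).toLp _‖ₑ ^ 2 = ∏ i, ‖φ i‖ₑ ^ 2 := by
    intro σ
    have h1 := hinner σ σ
    rw [hsq, one_mul, Equiv.prod_comp σ (fun i => inner 𝕜 (φ i) (φ i))] at h1
    simp_rw [inner_self_eq_norm_sq_to_K] at h1
    have h2 : ‖(hmem σ).toLp _‖ ^ 2 = ∏ i, ‖φ i‖ ^ 2 := by exact_mod_cast h1
    simp only [← ofReal_norm, ← ENNReal.ofReal_pow (norm_nonneg _)]
    rw [h2, ENNReal.ofReal_prod_of_nonneg fun _ _ => by positivity]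
  have hdet : ∀ x, (collocationMatrix φ x).det = ∑ σ, h σ x := by
    intro x
    rw [← Matrix.det_transpose, Matrix.det_apply']
    rfl
  calc ∫⁻ x, ‖(collocationMatrix φ x).det‖ₑ ^ 2 ∂ℙ
      = ‖∑ σ, (hmem σ).toLp _‖ₑ ^ 2 := by
        rw [enorm_Lp_sq]
        refine lintegral_congr_ae ?_
        have h2 : ∀ᵐ x ∂ℙ, ∀ σ, (hmem σ).toLp _ x = h σ x :=
          ae_all_iff.2 fun σ => (hmem σ).coeFn_toLp
        filter_upwards [Lp.coeFn_finsetSum Finset.univ fun σ => (hmem σ).toLp _, h2] with x hx hx2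
        rw [hx, Finset.sum_apply, hdet]
        simp_rw [hx2]
    _ = _ := by
        rw [enorm_sum_sq_of_pairwise_inner_eq_zero horth]
        simp only [hnorm, Finset.sum_const, Finset.card_univ, Fintype.card_perm, Fintype.card_fin,
          nsmul_eq_mul]

end Determinant

namespace LinearSampling

variable {𝕜 : Type*} [RCLike 𝕜] {X : Type} [MeasurableSpace X] {μ : Measure X}
  [IsProbabilityMeasure μ] {n : ℕ}

/-- The distribution of the nodes of random interpolation. -/
def nodeMeasure (e : Fin n → Lp 𝕜 2 μ) : Measure (Fin n → X) :=
  (Measure.pi fun _ => μ).withDensity fun x =>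
    (n.factorial : ℝ≥0∞)⁻¹ * ‖(collocationMatrix e x).det‖ₑ ^ 2

lemma isProbabilityMeasure_nodeMeasure {e : Fin n → Lp 𝕜 2 μ} (he : Orthonormal 𝕜 e) :
    IsProbabilityMeasure (nodeMeasure e) := by
  refine ⟨?_⟩
  have h1 : ∀ j, ‖e j‖ₑ = 1 := fun j => by rw [← ofReal_norm, he.1 j, ENNReal.ofReal_one]
  rw [nodeMeasure, withDensity_apply _ .univ, setLIntegral_univ,
    lintegral_const_mul _ ((measurable_det_collocationMatrix e).enorm.pow_const 2),
    lintegral_enorm_det_collocationMatrix_sq he.2]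
  simp only [h1, one_pow, Finset.prod_const_one, mul_one]
  exact ENNReal.inv_mul_cancel (Nat.cast_ne_zero.2 n.factorial_ne_zero)
    (ENNReal.natCast_ne_top _)

/-- Interpolation at random nodes that are drawn with a density proportional to the squared
modulus of the determinant of the collocation matrix. -/
def interpolation (e : Fin n → Lp 𝕜 2 μ) (he : Orthonormal 𝕜 e) : LinearSampling 𝕜 μ n where
  Ω := Fin n → X
  ℙ := nodeMeasure e
  isProbabilityMeasure := isProbabilityMeasure_nodeMeasure he
  ι := Fin n
  x := fun i ω => ω i
  quasiMeasurePreserving_x := fun i =>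
    (Measure.quasiMeasurePreserving_eval (fun _ => μ) i).mono_left
      (withDensity_absolutelyContinuous _ _)
  a := fun i j ω => (collocationMatrix e ω)⁻¹ j i
  measurable_a := fun i j => by
    simp_rw [Matrix.inv_def, Matrix.smul_apply, Ring.inverse_eq_inv', Matrix.adjugate_apply,
      Matrix.det_apply, smul_eq_mul]
    refine Measurable.mul (Measurable.inv ?_) ?_
    · simp_rw [← Matrix.det_apply]
      exact measurable_det_collocationMatrix e
    · refine Finset.measurable_sum _ fun σ _ => Measurable.const_smul
        (Finset.measurable_prod _ fun k _ => ?_) _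
      by_cases hk : σ k = i
      · simp only [hk, Matrix.updateRow_self]
        exact measurable_const
      · simp only [Matrix.updateRow_ne hk]
        exact (Lp.stronglyMeasurable (e k)).measurable.comp (measurable_pi_apply _)

/-- Interpolation is exact on the span, so the coefficient error is the interpolant of the residual
`g`. By Cramer's rule it is a quotient whose denominator is the collocation determinant, and the
node density cancels this denominator. What remains is the determinant of the system with `e j`
replaced by `g`, still orthogonal, whose second moment is known; each `j` contributes at most
`‖g‖²`. -/
lemma sqError_interpolation_le {e : Fin n → Lp 𝕜 2 μ} (he : Orthonormal 𝕜 e) (f : Lp 𝕜 2 μ) :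
    (interpolation e he).sqError e f ≤
      n * ‖f - ∑ j, inner 𝕜 (e j) f • e j‖ₑ ^ 2 := by
  set g : Lp 𝕜 2 μ := f - ∑ j, inner 𝕜 (e j) f • e j with hg
  have hge : ∀ j, inner 𝕜 (e j) g = 0 := fun j => by
    simp only [g, inner_sub_right, inner_sum, inner_smul_right]
    simp [orthonormal_iff_ite.1 he]
  have h1 : ∀ j, ‖e j‖ₑ = 1 := fun j => by rw [← ofReal_norm, he.1 j, ENNReal.ofReal_one]
  have hdet : ∀ j, ∫⁻ x, ‖(collocationMatrix (Function.update e j g) x).det‖ₑ ^ 2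
      ∂(Measure.pi fun _ => μ) = n.factorial * ‖g‖ₑ ^ 2 := by
    intro j
    rw [lintegral_enorm_det_collocationMatrix_sq]
    · congr 1
      rw [Finset.prod_eq_single j]
      · rw [Function.update_self]
      · intro k _ hk
        rw [Function.update_of_ne hk, h1, one_pow]
      · simp
    · intro k l hkl
      rcases eq_or_ne k j with rfl | hk
      · rw [Function.update_self, Function.update_of_ne hkl.symm, ← inner_conj_symm, hge, map_zero]
      · rcases eq_or_ne l j with rfl | hl
        · rw [Function.update_self, Function.update_of_ne hk, hge]
        · rw [Function.update_of_ne hk, Function.update_of_ne hl]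
          exact he.2 hkl
  have hgx : ∀ᵐ x : Fin n → X ∂(Measure.pi fun _ => μ), ∀ i,
      f (x i) = g (x i) + ∑ j, inner 𝕜 (e j) f * e j (x i) := by
    have h2 : ∀ᵐ x ∂μ, f x = g x + ∑ j, inner 𝕜 (e j) f * e j x := by
      have h3 : ∀ᵐ x ∂μ, ∀ k, (inner 𝕜 (e k) f • e k : Lp 𝕜 2 μ) x = inner 𝕜 (e k) f * e k x :=
        ae_all_iff.2 fun k => Lp.coeFn_smul _ (e k)
      filter_upwards [h3, Lp.coeFn_sub f (∑ j, inner 𝕜 (e j) f • e j),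
        Lp.coeFn_finsetSum Finset.univ fun j => inner 𝕜 (e j) f • e j] with x hx1 hx2 hx3
      rw [hg, hx2, Pi.sub_apply, hx3, Finset.sum_apply]
      simp_rw [hx1]
      simp
    exact ae_all_iff.2 fun i => (Measure.quasiMeasurePreserving_eval (fun _ => μ) i).ae h2
  have hm : ∀ j, Measurable fun ω : Fin n → X =>
      ‖(interpolation e he).coef f ω j - inner 𝕜 (e j) f‖ₑ ^ 2 := fun j =>
    (((interpolation e he).measurable_coef (Lp.stronglyMeasurable f).measurable
      j).sub_const _).enorm.pow_const 2
  have hfac : (n.factorial : ℝ≥0∞)⁻¹ * n.factorial = 1 :=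
    ENNReal.inv_mul_cancel (Nat.cast_ne_zero.2 n.factorial_ne_zero) (ENNReal.natCast_ne_top _)
  have key : ∀ j, ∫⁻ ω, ‖(interpolation e he).coef f ω j - inner 𝕜 (e j) f‖ₑ ^ 2
      ∂(nodeMeasure e) ≤ ‖g‖ₑ ^ 2 := by
    intro j
    rw [nodeMeasure, lintegral_withDensity_eq_lintegral_mul _
      (((measurable_det_collocationMatrix e).enorm.pow_const 2).const_mul _) (hm j)]
    calc _ ≤ ∫⁻ x, (n.factorial : ℝ≥0∞)⁻¹ *
          ‖(collocationMatrix (Function.update e j g) x).det‖ₑ ^ 2 ∂(Measure.pi fun _ => μ) := by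
          refine lintegral_mono_ae ?_
          filter_upwards [hgx] with x hx
          rw [Pi.mul_apply, mul_assoc]
          gcongr
          rw [← mul_pow, ← enorm_mul]
          -- Singular node configurations carry zero density, so the arbitrary value of the inverse
          -- there does no harm.
          rcases eq_or_ne (collocationMatrix e x).det 0 with h0 | h0
          · simp [h0]
          · refine le_of_eq ?_
            congr 2
            set B := collocationMatrix e x
            have hu : IsUnit B.det := h0.isUnit
            have hfx : (fun i => f (x i)) =
                (fun i => g (x i)) + B.mulVec fun j => inner 𝕜 (e j) f := by
              ext i
              rw [hx i]
              simp [B, Matrix.mulVec, dotProduct, collocationMatrix, mul_comm]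
            have hc : (interpolation e he).coef f x j = B⁻¹.mulVec (fun i => f (x i)) j := rfl
            have hcr : B.updateCol j (fun i => g (x i)) =
                collocationMatrix (Function.update e j g) x := by
              ext i k
              rcases eq_or_ne k j with rfl | hk
              · simp [collocationMatrix]
              · simp [collocationMatrix, B, hk]
            rw [hc, hfx, Matrix.mulVec_add, Matrix.mulVec_mulVec, Matrix.nonsing_inv_mul _ hu,
              Matrix.one_mulVec, Pi.add_apply, add_sub_cancel_right, Matrix.inv_def,
              Matrix.smul_mulVec, ← Matrix.cramer_eq_adjugate_mulVec, Pi.smul_apply,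
              Matrix.cramer_apply, hcr, Ring.inverse_eq_inv', smul_eq_mul,
              mul_inv_cancel_left₀ h0]
      _ = ‖g‖ₑ ^ 2 := by
          rw [lintegral_const_mul _ ((measurable_det_collocationMatrix _).enorm.pow_const 2),
            hdet, ← mul_assoc, hfac, one_mul]
  calc (interpolation e he).sqError e f
      = ∑ j, ∫⁻ ω, ‖(interpolation e he).coef f ω j - inner 𝕜 (e j) f‖ₑ ^ 2
          ∂(nodeMeasure e) := lintegral_finsetSum _ fun j _ => hm j
    _ ≤ ∑ _j : Fin n, ‖g‖ₑ ^ 2 := Finset.sum_le_sum fun j _ => key j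
    _ = _ := by simp

end LinearSampling

end Interpolation

/-! ### From linear sampling to randomized algorithms using function values -/

section SamplingAlgorithm

lemma measurable_nullMeasurableSpace {Ω β : Type*} [MeasurableSpace Ω] [MeasurableSpace β]
    {ℙ : Measure Ω} {h : Ω → β} (hh : NullMeasurable h ℙ) :
    Measurable fun ω : NullMeasurableSpace Ω ℙ => h ω :=
  fun _ hs => hh hs

lemma lintegral_completion_of_measurable {Ω : Type*} [MeasurableSpace Ω] {ℙ : Measure Ω}
    {h : Ω → ℝ≥0∞} (hh : Measurable h) : ∫⁻ ω, h ω ∂ℙ.completion = ∫⁻ ω, h ω ∂ℙ := by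
  let i : NullMeasurableSpace Ω ℙ → Ω := fun ω => ω
  have hid : Measurable i := fun s hs => (hs.nullMeasurableSet : NullMeasurableSet s ℙ)
  have hmp : MeasurePreserving i ℙ.completion ℙ :=
    ⟨hid, Measure.ext fun s hs => Measure.map_apply hid hs⟩
  exact hmp.lintegral_comp hh

namespace ApproxProblem

variable {𝕜 : Type*} [RCLike 𝕜] {d : ℕ} (P : ApproxProblem 𝕜 d)

instance : IsProbabilityMeasure P.μ :=
  ⟨by rw [μ, withDensity_apply _ .univ, setLIntegral_univ, P.lintegral_ρ]⟩

lemma app_ae_eq (f : P.F) : P.app f =ᵐ[P.μ] P.toFun f := (P.memLp f).coeFn_toLp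

/-- The embedding as a continuous linear map. -/
def appL : P.F →L[𝕜] P.G :=
  ContinuousLinearMap.mkOfIsCompactOperator (σ₁₂ := RingHom.id 𝕜)
    (f := { toFun := P.app
            map_add' := fun f g => by
              ext1
              filter_upwards [P.app_ae_eq (f + g), P.app_ae_eq f, P.app_ae_eq g,
                Lp.coeFn_add (P.app f) (P.app g)] with x h1 h2 h3 h4
              rw [h4, Pi.add_apply, h1, h2, h3, map_add, Pi.add_apply]
            map_smul' := fun c f => by
              ext1
              filter_upwards [P.app_ae_eq (c • f), P.app_ae_eq f,
                Lp.coeFn_smul c (P.app f)] with x h1 h2 h3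
              rw [RingHom.id_apply, h3, Pi.smul_apply, h1, h2, map_smul, Pi.smul_apply] }) P.isCompactOperator

@[simp] lemma appL_apply (f : P.F) : P.appL f = P.app f := rfl

lemma isCompactOperator_appL : IsCompactOperator P.appL := P.isCompactOperator

/-- Function evaluation at a point. -/
def evalAt (x : P.D) : P.F →ₗ[𝕜] 𝕜 := LinearMap.proj x ∘ₗ P.toFun

variable {P} {n : ℕ}

/-- Elements of `F` are only almost everywhere measurable; composing with the node map gives null
measurability, which the completed space turns into measurability. -/
lemma measurable_toFun_comp_nullMeasurableSpace (Q : LinearSampling 𝕜 P.μ n) (i : Q.ι) (f : P.F) :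
    Measurable fun ω : NullMeasurableSpace Q.Ω Q.ℙ => P.toFun f (Q.x i ω) :=
  measurable_nullMeasurableSpace
    (AEMeasurable.nullMeasurable
      ((show MemLp (P.toFun f) 2 P.μ from P.memLp f).aestronglyMeasurable.aemeasurable
        |>.comp_quasiMeasurePreserving (Q.quasiMeasurePreserving_x i)))

/-- The node of a sampling method with a given number (numbers that are too large are reduced). -/
def nodeIndex (Q : LinearSampling 𝕜 P.μ n) [Nonempty Q.ι] (j : ℕ) : Q.ι :=
  (Fintype.equivFin Q.ι).symm ⟨j % Fintype.card Q.ι, Nat.mod_lt _ Fintype.card_pos⟩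

lemma nodeIndex_equivFin (Q : LinearSampling 𝕜 P.μ n) [Nonempty Q.ι] (i : Q.ι) :
    nodeIndex Q (Fintype.equivFin Q.ι i) = i := by
  rw [nodeIndex, Equiv.symm_apply_eq]
  ext
  exact Nat.mod_eq_of_lt (Fintype.equivFin Q.ι i).2

/-- The approximation of `∑ j, c j • e j` from the given values at the nodes. -/
def reconstruct (e : Fin n → P.G) (Q : LinearSampling 𝕜 P.μ n) (ω : Q.Ω) (k : ℕ)
    (y : Fin k → 𝕜) : P.G :=
  ∑ j, (∑ i, Q.a i j ω *
    if h : (Fintype.equivFin Q.ι i : ℕ) < k then y ⟨Fintype.equivFin Q.ι i, h⟩ else 0) • e j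

lemma reconstruct_eq (e : Fin n → P.G) (Q : LinearSampling 𝕜 P.μ n) [Nonempty Q.ι] (ω : Q.Ω)
    (f : P.F) :
    (reconstruct e Q ω (Fintype.card Q.ι) fun j => P.evalAt (Q.x (nodeIndex Q j) ω) f) =
      ∑ j, Q.coef (P.toFun f) ω j • e j := by
  simp only [reconstruct, LinearSampling.coef]
  refine Finset.sum_congr rfl fun j _ => ?_
  congr 1
  refine Finset.sum_congr rfl fun i _ => ?_
  rw [dif_pos (Fintype.equivFin Q.ι i).2, nodeIndex_equivFin]
  rfl

/-- The randomized algorithm that is given by a linear sampling method. The probability space is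
completed since the elements of `F` need not be Borel measurable. -/
def ofLinearSampling (e : Fin n → P.G) (Q : LinearSampling 𝕜 P.μ n) [Nonempty Q.ι] :
    P.RandAlgorithm .std where
  Ω := NullMeasurableSpace Q.Ω Q.ℙ
  ℙ := Q.ℙ.completion
  isProbabilityMeasure := ⟨measure_univ (μ := Q.ℙ)⟩
  L := fun j ω => P.evalAt (Q.x (nodeIndex Q j) ω)
  L_mem := fun j ω => ⟨_, fun _ => rfl⟩
  n := fun _ _ => Fintype.card Q.ι
  n_congr := fun _ _ _ _ => rfl
  φ := fun ω k y => reconstruct e Q ω k y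
  stronglyMeasurable_φ := fun ω k => by
    refine Finset.stronglyMeasurable_fun_sum _ fun j _ => ?_
    refine (Measurable.stronglyMeasurable (Finset.measurable_sum _ fun i _ => ?_)).smul_const _
    refine Measurable.const_mul ?_ _
    split_ifs
    · exact measurable_pi_apply _
    · exact measurable_const
  measurable_n := fun _ _ => measurable_const
  stronglyMeasurable_output := fun k v => by
    have h1 : ∀ p : (Fin k → 𝕜) × NullMeasurableSpace Q.Ω Q.ℙ,
        (reconstruct e Q p.2 (Fintype.card Q.ι) fun j =>
          P.evalAt (Q.x (nodeIndex Q j) p.2) (∑ i, p.1 i • v i)) =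
        ∑ j, (∑ i, Q.a i j p.2 * ∑ l, p.1 l * P.toFun (v l) (Q.x i p.2)) • e j := by
      intro p
      refine (reconstruct_eq e Q p.2 _).trans (Finset.sum_congr rfl fun j _ => ?_)
      simp [LinearSampling.coef]
    simp_rw [h1]
    refine Finset.stronglyMeasurable_fun_sum _ fun j _ => ?_
    refine (Measurable.stronglyMeasurable (Finset.measurable_sum _ fun i _ => ?_)).smul_const _
    have ha : Measurable fun ω : NullMeasurableSpace Q.Ω Q.ℙ => Q.a i j ω :=
      measurable_nullMeasurableSpace (Q.measurable_a i j).nullMeasurable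
    refine (ha.comp measurable_snd).mul (Finset.measurable_sum _ fun l _ => ?_)
    exact ((measurable_pi_apply l).comp measurable_fst).mul
      ((measurable_toFun_comp_nullMeasurableSpace Q i (v l)).comp measurable_snd)

lemma card_ofLinearSampling_le (e : Fin n → P.G) (Q : LinearSampling 𝕜 P.μ n) [Nonempty Q.ι] :
    (ofLinearSampling e Q).card ≤ Fintype.card Q.ι := by
  refine iSup₂_le fun f _ => ?_
  have : ∫⁻ _ω, ((Fintype.card Q.ι : ℕ) : ℝ≥0∞) ∂(ofLinearSampling e Q).ℙ = Fintype.card Q.ι := by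
    rw [lintegral_const, measure_univ, mul_one]
  exact this.le

lemma lintegral_sq_ofLinearSampling {e : Fin n → P.G} (he : Orthonormal 𝕜 e)
    (Q : LinearSampling 𝕜 P.μ n) [Nonempty Q.ι] (f : P.F) :
    ∫⁻ ω, ‖P.app f - (ofLinearSampling e Q).output f ω‖ₑ ^ 2 ∂(ofLinearSampling e Q).ℙ =
      ‖P.app f - ∑ j, inner 𝕜 (e j) (P.app f) • e j‖ₑ ^ 2 + Q.sqError e (P.app f) := by
  have hm : Measurable fun ω : Q.Ω =>
      ∑ j, ‖Q.coef (P.app f) ω j - inner 𝕜 (e j) (P.app f)‖ₑ ^ 2 :=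
    Finset.measurable_sum _ fun j _ => ((Q.measurable_coef
      (Lp.stronglyMeasurable (P.app f)).measurable j).sub_const _).enorm.pow_const 2
  have hae := Q.coef_congr_ae (P.app_ae_eq f)
  calc _ = ∫⁻ ω, (‖P.app f - ∑ j, inner 𝕜 (e j) (P.app f) • e j‖ₑ ^ 2 +
        ∑ j, ‖Q.coef (P.app f) ω j - inner 𝕜 (e j) (P.app f)‖ₑ ^ 2) ∂Q.ℙ.completion := by
        refine lintegral_congr_ae ?_
        have hae' : ∀ᵐ ω ∂Q.ℙ.completion, ∀ j,
            Q.coef (P.app f) ω j = Q.coef (P.toFun f) ω j := hae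
        filter_upwards [hae'] with ω hω
        have : (ofLinearSampling e Q).output f ω = ∑ j, Q.coef (P.app f) ω j • e j :=
          (reconstruct_eq e Q ω f).trans
            (Finset.sum_congr rfl fun j _ => congrArg (· • e j) (hω j).symm)
        rw [this, enorm_sub_sum_smul_sq he]
    _ = _ := lintegral_completion_of_measurable (hm.const_add _)
    _ = _ := by
        rw [lintegral_add_left measurable_const, lintegral_const, measure_univ, mul_one]
        rfl

/-- Approximation from a space that is spanned by `n` orthonormal functions is almost as good with
random samples as with optimal information. -/
theorem minError_ran_std_le {e : Fin n → P.G} (he : Orthonormal 𝕜 e) (hn : n ≠ 0) {τ : ℝ}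
    (hτ : 0 ≤ τ)
    (h : ∀ f, ‖P.app f - ∑ j, inner 𝕜 (e j) (P.app f) • e j‖ ≤ τ * ‖f‖) {K : ℕ} (hK : 2 ≤ K) :
    P.minError .ran .std (n * (1 + K * (Nat.clog 2 n + 1))) ≤
      ENNReal.ofReal (√(1 + 3 / K) * τ) := by
  have hK0 : (K : ℝ≥0∞) ≠ 0 := Nat.cast_ne_zero.2 (by lia)
  -- With `n * K` points the Monte Carlo factor `n / m` equals `1 / K`.
  let M := LinearSampling.monteCarlo e he hn (n * K)
  let Q := (LinearSampling.interpolation e he).iterate e M (Nat.clog 2 n + 1)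
  set q : ℝ≥0∞ := (K : ℝ≥0∞)⁻¹ with hq
  have hM : ∀ f, M.sqError e f ≤ q * ‖f‖ₑ ^ 2 := fun f => by
    refine (LinearSampling.sqError_monteCarlo_le he hn
      (Nat.mul_ne_zero hn (by lia)) f).trans_eq ?_
    congr 1
    rw [Nat.cast_mul, ENNReal.div_eq_inv_mul, ENNReal.mul_inv (Or.inr (ENNReal.natCast_ne_top _))
      (Or.inr hK0), mul_right_comm, ENNReal.inv_mul_cancel (Nat.cast_ne_zero.2 hn)
      (ENNReal.natCast_ne_top _), one_mul]
  have hq2 : 2 * q ≤ 1 := by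
    rw [hq, ← div_eq_mul_inv]
    refine ENNReal.div_le_of_le_mul ?_
    rw [one_mul]
    exact_mod_cast hK
  -- Since `K ≥ 2`, `Nat.clog 2 n` rounds cancel the factor `n` of interpolation and the extra round
  -- leaves `q`. The total is `2 * q + q = 3 / K`.
  have hqn : q ^ (Nat.clog 2 n + 1) * n ≤ q := by
    rw [pow_succ, mul_right_comm]
    refine mul_le_of_le_one_left' ?_
    rw [hq, ← ENNReal.inv_pow, ← ENNReal.div_eq_inv_mul]
    refine ENNReal.div_le_of_le_mul ?_
    rw [one_mul]
    have h1 : n ≤ 2 ^ Nat.clog 2 n := Nat.le_pow_clog one_lt_two n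
    have h2 : 2 ^ Nat.clog 2 n ≤ K ^ Nat.clog 2 n := Nat.pow_le_pow_left hK _
    exact_mod_cast h1.trans h2
  have hcard : Fintype.card Q.ι = n * (1 + K * (Nat.clog 2 n + 1)) := by
    rw [LinearSampling.card_iterate]
    have h1 : Fintype.card (LinearSampling.interpolation e he).ι = n := Fintype.card_fin n
    have h2 : Fintype.card M.ι = n * K := Fintype.card_fin _
    rw [h1, h2]
    ring
  have hpos : 0 < Fintype.card Q.ι := by rw [hcard]; positivity
  have : Nonempty Q.ι := Fintype.card_pos_iff.1 hpos
  have herr : (ofLinearSampling e Q).error ≤ ENNReal.ofReal (√(1 + 3 / K) * τ) := by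
    refine iSup₂_le fun f hf => ?_
    rw [lintegral_sq_ofLinearSampling he]
    have h1 := LinearSampling.sqError_iterate_le _ he M hq2 hM
      (LinearSampling.sqError_interpolation_le he) (Nat.clog 2 n + 1) (P.app f)
    have h2 : ‖P.app f - ∑ j, inner 𝕜 (e j) (P.app f) • e j‖ₑ ≤ ENNReal.ofReal τ := by
      rw [← ofReal_norm]
      refine ENNReal.ofReal_le_ofReal ((h f).trans ?_)
      nlinarith
    have h3 : ‖P.app f - ∑ j, inner 𝕜 (e j) (P.app f) • e j‖ₑ ^ 2 + Q.sqError e (P.app f) ≤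
        ENNReal.ofReal (√(1 + 3 / K) * τ) ^ 2 := by
      calc _ ≤ ENNReal.ofReal τ ^ 2 + (2 * q + q) * ENNReal.ofReal τ ^ 2 := by
            refine add_le_add (by gcongr) (h1.trans ?_)
            gcongr
        _ = (1 + 3 * q) * ENNReal.ofReal τ ^ 2 := by ring
        _ = _ := by
            rw [ENNReal.ofReal_mul (Real.sqrt_nonneg _), mul_pow,
              ← ENNReal.ofReal_pow (Real.sqrt_nonneg _), Real.sq_sqrt (by positivity),
              ENNReal.ofReal_add zero_le_one (by positivity), ENNReal.ofReal_one,
              ENNReal.ofReal_div_of_pos (by positivity), ENNReal.ofReal_natCast,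
              ENNReal.ofReal_ofNat, div_eq_mul_inv]
    refine (ENNReal.rpow_le_rpow h3 (by norm_num)).trans_eq ?_
    rw [← ENNReal.rpow_natCast, ← ENNReal.rpow_mul]
    norm_num
  rw [← hcard, minError, if_neg hpos.ne']
  exact (iInf₂_le (ofLinearSampling e Q) (card_ofLinearSampling_le e Q)).trans herr

end ApproxProblem

end SamplingAlgorithm

/-! ### Averaging over an invariant measure on the sphere -/

section InvariantMeasure

section InvariantMeasure

/-- A probability measure on unit vectors that is invariant under linear isometries. -/
lemma exists_invariant_measure_real (E : Type*) [NormedAddCommGroup E] [InnerProductSpace ℝ E]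
    [FiniteDimensional ℝ E] [MeasurableSpace E] [BorelSpace E] [Nontrivial E] :
    ∃ ν : Measure E, IsProbabilityMeasure ν ∧ (∀ᵐ p ∂ν, ‖p‖ = 1) ∧
      ∀ U : E ≃ₗᵢ[ℝ] E, MeasurePreserving U ν ν := by
  -- The measure is the uniform distribution on the ball pushed radially onto the sphere; isometries
  -- preserve the former and commute with the radial map.
  let ν₀ : Measure E := ProbabilityTheory.cond volume (Metric.ball 0 1)
  have hν₀ : IsProbabilityMeasure ν₀ :=
    ProbabilityTheory.cond_isProbabilityMeasure_of_finite
      (Metric.measure_ball_pos volume 0 one_pos).ne' measure_ball_lt_top.ne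
  let g : E → E := fun p => ‖p‖⁻¹ • p
  have hg : Measurable g := measurable_norm.inv.smul measurable_id
  have hU₀ : ∀ U : E ≃ₗᵢ[ℝ] E, MeasurePreserving U ν₀ ν₀ := by
    intro U
    have h1 := U.measurePreserving.restrict_preimage (s := Metric.ball 0 1)
      measurableSet_ball
    have h2 : U ⁻¹' Metric.ball 0 1 = Metric.ball 0 1 := by
      ext p
      simp
    rw [h2] at h1
    exact h1.smul_measure _
  refine ⟨ν₀.map g, Measure.isProbabilityMeasure_map hg.aemeasurable, ?_, fun U => ?_⟩
  · rw [ae_map_iff hg.aemeasurable (measurableSet_eq_fun measurable_norm measurable_const)]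
    have h0 : ∀ᵐ p ∂ν₀, p ≠ 0 := by
      have h : ν₀ ≪ volume := ProbabilityTheory.cond_absolutelyContinuous
      exact h.ae_le (ae_iff.2 (by simp))
    filter_upwards [h0] with p hp
    simp [g, norm_smul, hp]
  · refine ⟨U.continuous.measurable, ?_⟩
    rw [Measure.map_map U.continuous.measurable hg]
    have : U ∘ g = g ∘ U := by
      ext p
      simp [g]
    rw [this, ← Measure.map_map hg U.continuous.measurable, (hU₀ U).map_eq]

variable {𝕜 : Type*} [RCLike 𝕜] {M : ℕ}

lemma exists_invariant_measure (𝕜 E : Type*) [RCLike 𝕜] [NormedAddCommGroup E]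
    [InnerProductSpace 𝕜 E] [FiniteDimensional 𝕜 E] [MeasurableSpace E] [BorelSpace E]
    [Nontrivial E] :
    ∃ ν : Measure E, IsProbabilityMeasure ν ∧ (∀ᵐ p ∂ν, ‖p‖ = 1) ∧
      ∀ U : E ≃ₗᵢ[𝕜] E, MeasurePreserving U ν ν := by
  let _ : InnerProductSpace ℝ E := InnerProductSpace.rclikeToReal 𝕜 E
  have : IsScalarTower ℝ 𝕜 E :=
    ⟨fun r c x => by
      rw [RCLike.real_smul_eq_coe_mul, mul_smul]
      rfl⟩
  have : FiniteDimensional ℝ E := FiniteDimensional.trans ℝ 𝕜 E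
  obtain ⟨ν, h1, h2, h3⟩ := exists_invariant_measure_real E
  refine ⟨ν, h1, h2, fun U => ?_⟩
  let U' : E ≃ₗᵢ[ℝ] E :=
    { U with
      map_smul' := fun r p => U.map_smul (r : 𝕜) p }
  exact h3 U'

variable {ν : Measure (EuclideanSpace 𝕜 (Fin M))} [IsProbabilityMeasure ν]

/-- A unitary map carries any unit vector to any other, so the integral does not depend on `u`; over
an orthonormal basis of `M` vectors the integrals sum to `1`. -/
lemma lintegral_inner_sq_of_invariant [NeZero M] (h1 : ∀ᵐ p ∂ν, ‖p‖ = 1)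
    (hU : ∀ U : EuclideanSpace 𝕜 (Fin M) ≃ₗᵢ[𝕜] EuclideanSpace 𝕜 (Fin M), MeasurePreserving U ν ν)
    {u : EuclideanSpace 𝕜 (Fin M)} (hu : ‖u‖ = 1) :
    ∫⁻ p, ‖inner 𝕜 u p‖ₑ ^ 2 ∂ν = (M : ℝ≥0∞)⁻¹ := by
  let b₀ := EuclideanSpace.basisFun (Fin M) 𝕜
  have hm : ∀ v : EuclideanSpace 𝕜 (Fin M), Measurable fun p => ‖inner 𝕜 v p‖ₑ ^ 2 := fun v =>
    (Continuous.inner continuous_const continuous_id).measurable.enorm.pow_const 2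
  have hconst : ∀ v : EuclideanSpace 𝕜 (Fin M), ‖v‖ = 1 →
      ∫⁻ p, ‖inner 𝕜 v p‖ₑ ^ 2 ∂ν = ∫⁻ p, ‖inner 𝕜 (b₀ 0) p‖ₑ ^ 2 ∂ν := by
    intro v hv
    have horth : Orthonormal 𝕜 (({0} : Set (Fin M)).domRestrict fun _ => v) :=
      ⟨fun _ => hv, fun i j hij => absurd (Subsingleton.elim i j) hij⟩
    obtain ⟨b, hb⟩ := horth.exists_orthonormalBasis_extension_of_card_eq
      (by simp : Module.finrank 𝕜 (EuclideanSpace 𝕜 (Fin M)) = Fintype.card (Fin M))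
    let U := b.equiv b₀ (Equiv.refl _)
    have hUv : U v = b₀ 0 := by
      rw [← hb 0 rfl, OrthonormalBasis.equiv_apply_basis, Equiv.refl_apply]
    rw [← (hU U).lintegral_comp (hm (b₀ 0)), ← hUv]
    simp only [LinearIsometryEquiv.inner_map_map]
  have hsum : ∑ i, ∫⁻ p, ‖inner 𝕜 (b₀ i) p‖ₑ ^ 2 ∂ν = 1 := by
    rw [← lintegral_finsetSum _ fun i _ => hm _]
    have : ∀ᵐ p ∂ν, ∑ i, ‖inner 𝕜 (b₀ i) p‖ₑ ^ 2 = 1 := by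
      filter_upwards [h1] with p hp
      have h := b₀.sum_sq_norm_inner_right p
      simp only [← ofReal_norm, ← ENNReal.ofReal_pow (norm_nonneg _)]
      rw [← ENNReal.ofReal_sum_of_nonneg fun _ _ => by positivity, h, hp]
      simp
    rw [lintegral_congr_ae this, lintegral_const, measure_univ, mul_one]
  have hall : ∀ i, ∫⁻ p, ‖inner 𝕜 (b₀ i) p‖ₑ ^ 2 ∂ν = ∫⁻ p, ‖inner 𝕜 u p‖ₑ ^ 2 ∂ν := fun i => by
    rw [hconst u hu, hconst _ (b₀.norm_eq_one i)]
  simp_rw [hall] at hsum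
  rw [Finset.sum_const, Finset.card_univ, Fintype.card_fin, nsmul_eq_mul] at hsum
  exact ENNReal.eq_inv_of_mul_eq_one_left (by rwa [mul_comm])

lemma lintegral_starProjection_sq_of_invariant [NeZero M] (h1 : ∀ᵐ p ∂ν, ‖p‖ = 1)
    (hU : ∀ U : EuclideanSpace 𝕜 (Fin M) ≃ₗᵢ[𝕜] EuclideanSpace 𝕜 (Fin M), MeasurePreserving U ν ν)
    (Z : Submodule 𝕜 (EuclideanSpace 𝕜 (Fin M))) :
    ∫⁻ p, ‖Z.starProjection p‖ₑ ^ 2 ∂ν = Module.finrank 𝕜 Z / M := by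
  let z := stdOrthonormalBasis 𝕜 Z
  have hm : ∀ v : EuclideanSpace 𝕜 (Fin M), Measurable fun p => ‖inner 𝕜 v p‖ₑ ^ 2 := fun v =>
    (Continuous.inner continuous_const continuous_id).measurable.enorm.pow_const 2
  have hz : ∀ p, ‖Z.starProjection p‖ₑ ^ 2 =
      ∑ i, ‖inner 𝕜 (z i : EuclideanSpace 𝕜 (Fin M)) p‖ₑ ^ 2 := by
    intro p
    have h := z.sum_sq_norm_inner_right (Z.orthogonalProjectionOnto p)
    simp only [Submodule.inner_orthogonalProjectionOnto_eq_of_mem_left] at h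
    simp only [← ofReal_norm, ← ENNReal.ofReal_pow (norm_nonneg _)]
    rw [← ENNReal.ofReal_sum_of_nonneg fun _ _ => by positivity, h]
    simp
  have hn : ∀ i, ‖(z i : EuclideanSpace 𝕜 (Fin M))‖ = 1 := fun i => z.norm_eq_one i
  simp_rw [hz]
  rw [lintegral_finsetSum _ fun i _ => hm _]
  simp_rw [fun i => lintegral_inner_sq_of_invariant h1 hU (hn i)]
  rw [Finset.sum_const, Finset.card_univ, Fintype.card_fin, nsmul_eq_mul, div_eq_mul_inv]

/-- Used with `a` and `b` the errors at two inputs sharing one output: their mean square is at least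
the square of half the distance between the two solutions. -/
lemma two_mul_enorm_sq_le {G : Type*} [SeminormedAddCommGroup G] [NormedSpace ℝ G] {a b c : G}
    (h : a - b = (2 : ℝ) • c) : 2 * ‖c‖ₑ ^ 2 ≤ ‖a‖ₑ ^ 2 + ‖b‖ₑ ^ 2 := by
  have h1 : 2 * ‖c‖ ≤ ‖a‖ + ‖b‖ := by
    have := norm_sub_le a b
    rw [h, norm_smul] at this
    simpa using this
  have h2 : 2 * ‖c‖ ^ 2 ≤ ‖a‖ ^ 2 + ‖b‖ ^ 2 := by
    nlinarith [norm_nonneg c, sq_nonneg (‖a‖ - ‖b‖)]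
  simp only [← ofReal_norm, ← ENNReal.ofReal_pow (norm_nonneg _)]
  rw [← ENNReal.ofReal_add (by positivity) (by positivity), ← ENNReal.ofReal_ofNat 2,
    ← ENNReal.ofReal_mul (by norm_num)]
  exact ENNReal.ofReal_le_ofReal h2

/-- The average error over unit vectors of a map `out` that depends on the values of `k` linear
functionals only, unless `N` exceeds `k`. -/
lemma le_lintegral_enorm_sub_sq [NeZero M] (h1 : ∀ᵐ p ∂ν, ‖p‖ = 1)
    (hU : ∀ U : EuclideanSpace 𝕜 (Fin M) ≃ₗᵢ[𝕜] EuclideanSpace 𝕜 (Fin M), MeasurePreserving U ν ν)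
    {G : Type*} [NormedAddCommGroup G] [NormedSpace 𝕜 G]
    (T : EuclideanSpace 𝕜 (Fin M) →ₗ[𝕜] G) {τ : ℝ} (hτ : 0 ≤ τ) (hT : ∀ p, τ * ‖p‖ ≤ ‖T p‖)
    (L : ℕ → EuclideanSpace 𝕜 (Fin M) →ₗ[𝕜] 𝕜) (N : EuclideanSpace 𝕜 (Fin M) → ℕ)
    (out : EuclideanSpace 𝕜 (Fin M) → G) (hN : Measurable N)
    (hout : Measurable fun p => ‖T p - out p‖ₑ)
    (hcongr : ∀ p p', (∀ j < N p, L j p' = L j p) → N p' = N p ∧ out p' = out p) (k : ℕ) :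
    ENNReal.ofReal τ ^ 2 * ((M - k : ℕ) / M) ≤
      ∫⁻ p, ‖T p - out p‖ₑ ^ 2 ∂ν + ENNReal.ofReal τ ^ 2 * ν {p | k < N p} := by
  let _ : NormedSpace ℝ G := NormedSpace.restrictScalars ℝ 𝕜 G
  let Λ : EuclideanSpace 𝕜 (Fin M) →ₗ[𝕜] (Fin k → 𝕜) := LinearMap.pi fun j => L j
  let Z : Submodule 𝕜 (EuclideanSpace 𝕜 (Fin M)) := LinearMap.ker Λ
  have hZ : M - k ≤ Module.finrank 𝕜 Z := by
    have h2 := LinearMap.finrank_range_add_finrank_ker Λ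
    have h3 := Submodule.finrank_le (LinearMap.range Λ)
    rw [finrank_euclideanSpace_fin] at h2
    rw [Module.finrank_fin_fun] at h3
    have h4 : ∀ a b : ℕ, a + b = M → a ≤ k → M - k ≤ b := by lia
    exact h4 _ _ h2 h3
  -- The reflection moves `p` by `2` times its component in `Z`, which the first `k` functionals do
  -- not see. It preserves `ν` and, on inputs that stop within `k` evaluations, the output; pairing
  -- `p` with `R p` bounds the error from below.
  let R := Zᗮ.reflection
  have hR : ∀ p, R p = p - (2 : 𝕜) • Z.starProjection p := fun p => by
    simp only [R]
    rw [Submodule.reflection_orthogonal_apply, Submodule.reflection_apply, two_smul, two_smul]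
    abel
  have hRL : ∀ p, ∀ j < k, L j (R p) = L j p := fun p j hj => by
    have h2 : Λ (Z.starProjection p) = 0 := LinearMap.mem_ker.1 (Z.starProjection_apply_mem p)
    have h3 : L j (Z.starProjection p) = 0 := congrFun h2 ⟨j, hj⟩
    rw [hR, map_sub, map_smul, h3, smul_zero, sub_zero]
  let S : Set (EuclideanSpace 𝕜 (Fin M)) := {p | N p ≤ k}
  have hS : MeasurableSet S := hN measurableSet_Iic
  have hRS : ∀ p ∈ S, N (R p) = N p ∧ out (R p) = out p := fun p hp =>
    hcongr p (R p) fun j hj => hRL p j (lt_of_lt_of_le hj hp)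
  have hpre : R ⁻¹' S = S := by
    have hle : ∀ p ∈ S, R p ∈ S := fun p hp => by
      change N (R p) ≤ k
      rw [(hRS p hp).1]
      exact hp
    ext p
    refine ⟨fun hp => ?_, hle p⟩
    have := hle _ hp
    rwa [Submodule.reflection_reflection] at this
  have hm2 : Measurable fun p => ‖T p - out p‖ₑ ^ 2 := hout.pow_const 2
  have hI : ∫⁻ p in S, ‖T p - out p‖ₑ ^ 2 ∂ν = ∫⁻ p in S, ‖T (R p) - out p‖ₑ ^ 2 ∂ν := by
    have h2 := ((hU R).restrict_preimage hS).lintegral_comp hm2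
    rw [hpre] at h2
    rw [← h2]
    exact setLIntegral_congr_fun hS fun p hp => by simp only [(hRS p hp).2]
  have hproj : ∫⁻ p in S, ENNReal.ofReal τ ^ 2 * ‖Z.starProjection p‖ₑ ^ 2 ∂ν ≤
      ∫⁻ p in S, ‖T p - out p‖ₑ ^ 2 ∂ν := by
    have h2 : 2 * ∫⁻ p in S, ENNReal.ofReal τ ^ 2 * ‖Z.starProjection p‖ₑ ^ 2 ∂ν ≤
        2 * ∫⁻ p in S, ‖T p - out p‖ₑ ^ 2 ∂ν := by
      rw [two_mul (∫⁻ p in S, ‖T p - out p‖ₑ ^ 2 ∂ν)]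
      nth_rewrite 2 [hI]
      rw [← lintegral_add_left hm2, ← lintegral_const_mul' _ _ (by norm_num)]
      refine lintegral_mono fun p => ?_
      refine le_trans ?_ (two_mul_enorm_sq_le (c := T (Z.starProjection p)) ?_)
      · gcongr
        rw [← mul_pow]
        gcongr
        rw [← ofReal_norm, ← ofReal_norm, ← ENNReal.ofReal_mul hτ]
        exact ENNReal.ofReal_le_ofReal (hT _)
      · rw [hR, map_sub, map_smul, two_smul, two_smul]
        abel
    exact (ENNReal.mul_le_mul_iff_right (by norm_num) (by norm_num)).1 h2
  have hcompl : ∫⁻ p in Sᶜ, ‖Z.starProjection p‖ₑ ^ 2 ∂ν ≤ ν {p | k < N p} := by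
    have hSc : Sᶜ = {p | k < N p} := by
      ext p
      simp [S]
    rw [hSc]
    calc _ ≤ ∫⁻ p in {p | k < N p}, 1 ∂ν := by
          refine lintegral_mono_ae ?_
          filter_upwards [ae_restrict_of_ae h1] with p hp
          have h2 := Submodule.norm_starProjection_apply_le Z p
          rw [hp] at h2
          have h3 : ‖Z.starProjection p‖ₑ ≤ 1 := by
            rw [← ofReal_norm, ← ENNReal.ofReal_one]
            exact ENNReal.ofReal_le_ofReal h2
          calc _ ≤ (1 : ℝ≥0∞) ^ 2 := by gcongr
            _ = 1 := one_pow 2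
      _ = _ := by rw [setLIntegral_one]
  have hmZ : Measurable fun p => ‖Z.starProjection p‖ₑ ^ 2 :=
    (Z.starProjection.continuous.measurable).enorm.pow_const 2
  calc ENNReal.ofReal τ ^ 2 * ((M - k : ℕ) / M)
      ≤ ENNReal.ofReal τ ^ 2 * (Module.finrank 𝕜 Z / M) := by gcongr
    _ = ENNReal.ofReal τ ^ 2 * (∫⁻ p in S, ‖Z.starProjection p‖ₑ ^ 2 ∂ν +
          ∫⁻ p in Sᶜ, ‖Z.starProjection p‖ₑ ^ 2 ∂ν) := by
        rw [lintegral_add_compl _ hS, lintegral_starProjection_sq_of_invariant h1 hU]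
    _ ≤ _ := by
        rw [mul_add, ← lintegral_const_mul _ hmZ]
        exact add_le_add (hproj.trans (setLIntegral_le_lintegral _ _)) (by gcongr)

end InvariantMeasure

end InvariantMeasure

/-! ### Lower bound for randomized algorithms -/

section RandomizedLowerBound

variable {𝕜 : Type*} [RCLike 𝕜]

/-- For each `ω` the deterministic bound applies, and Markov's inequality replaces the measure of `k
< N`, that is `k + 1 ≤ N`, by an expectation. Tonelli then exchanges the averages over inputs and
over `ω`. -/
lemma le_lintegral_lintegral_enorm_sub_sq {M : ℕ} [NeZero M]
    {ν : Measure (EuclideanSpace 𝕜 (Fin M))} [IsProbabilityMeasure ν]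
    {Ω : Type*} [MeasurableSpace Ω] {ℙ : Measure Ω} [IsProbabilityMeasure ℙ]
    (h1 : ∀ᵐ p ∂ν, ‖p‖ = 1)
    (hU : ∀ U : EuclideanSpace 𝕜 (Fin M) ≃ₗᵢ[𝕜] EuclideanSpace 𝕜 (Fin M), MeasurePreserving U ν ν)
    {G : Type*} [NormedAddCommGroup G] [NormedSpace 𝕜 G]
    (T : EuclideanSpace 𝕜 (Fin M) →ₗ[𝕜] G) {τ : ℝ} (hτ : 0 ≤ τ) (hT : ∀ p, τ * ‖p‖ ≤ ‖T p‖)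
    (L : ℕ → Ω → EuclideanSpace 𝕜 (Fin M) →ₗ[𝕜] 𝕜) (N : EuclideanSpace 𝕜 (Fin M) → Ω → ℕ)
    (out : EuclideanSpace 𝕜 (Fin M) → Ω → G)
    (hN : Measurable fun q : EuclideanSpace 𝕜 (Fin M) × Ω => N q.1 q.2)
    (hout : Measurable fun q : EuclideanSpace 𝕜 (Fin M) × Ω => ‖T q.1 - out q.1 q.2‖ₑ)
    (hcongr : ∀ ω p p', (∀ j < N p ω, L j ω p' = L j ω p) →
      N p' ω = N p ω ∧ out p' ω = out p ω) (k : ℕ) :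
    ENNReal.ofReal τ ^ 2 * ((M - k : ℕ) / M) ≤
      ∫⁻ p, ∫⁻ ω, ‖T p - out p ω‖ₑ ^ 2 ∂ℙ ∂ν +
        ENNReal.ofReal τ ^ 2 * ((∫⁻ p, ∫⁻ ω, (N p ω : ℝ≥0∞) ∂ℙ ∂ν) / (k + 1 : ℕ)) := by
  have hpoint : ∀ ω, ENNReal.ofReal τ ^ 2 * ((M - k : ℕ) / M) ≤
      ∫⁻ p, ‖T p - out p ω‖ₑ ^ 2 ∂ν +
        ENNReal.ofReal τ ^ 2 * ((∫⁻ p, (N p ω : ℝ≥0∞) ∂ν) / (k + 1 : ℕ)) := by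
    intro ω
    have hmk : Measurable fun p : EuclideanSpace 𝕜 (Fin M) => (p, ω) := measurable_prodMk_right
    have hNω : Measurable fun p => N p ω := hN.comp hmk
    refine (le_lintegral_enorm_sub_sq h1 hU T hτ hT (fun j => L j ω) (fun p => N p ω)
      (fun p => out p ω) hNω (hout.comp hmk) (hcongr ω) k).trans ?_
    refine add_le_add le_rfl ?_
    gcongr
    rw [ENNReal.le_div_iff_mul_le (Or.inl (by simp)) (Or.inl (ENNReal.natCast_ne_top _)), mul_comm]
    have hmeas : Measurable fun p => (N p ω : ℝ≥0∞) := measurable_from_top.comp hNω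
    refine le_trans ?_ (mul_meas_ge_le_lintegral hmeas ((k + 1 : ℕ) : ℝ≥0∞))
    gcongr
    intro hp
    exact_mod_cast Nat.succ_le_of_lt hp
  have hm1 : Measurable fun q : EuclideanSpace 𝕜 (Fin M) × Ω =>
      ‖T q.1 - out q.1 q.2‖ₑ ^ 2 := hout.pow_const 2
  have hm2 : Measurable fun q : EuclideanSpace 𝕜 (Fin M) × Ω => (N q.1 q.2 : ℝ≥0∞) :=
    measurable_from_top.comp hN
  calc ENNReal.ofReal τ ^ 2 * ((M - k : ℕ) / M)
      = ∫⁻ _ω, ENNReal.ofReal τ ^ 2 * ((M - k : ℕ) / M) ∂ℙ := by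
        rw [lintegral_const, measure_univ, mul_one]
    _ ≤ ∫⁻ ω, (∫⁻ p, ‖T p - out p ω‖ₑ ^ 2 ∂ν +
          ENNReal.ofReal τ ^ 2 * ((∫⁻ p, (N p ω : ℝ≥0∞) ∂ν) / (k + 1 : ℕ))) ∂ℙ :=
        lintegral_mono hpoint
    _ = _ := by
        rw [lintegral_add_left hm1.lintegral_prod_left', lintegral_const_mul' _ _ (by simp)]
        simp_rw [div_eq_mul_inv]
        rw [lintegral_mul_const' _ _ (by simp)]
        rw [lintegral_lintegral_swap (f := fun p ω => ‖T p - out p ω‖ₑ ^ 2) hm1.aemeasurable,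
          lintegral_lintegral_swap (f := fun p ω => (N p ω : ℝ≥0∞)) hm2.aemeasurable]

namespace ApproxProblem

variable {d : ℕ} {P : ApproxProblem 𝕜 d} {Λ : InfoClass}

lemma RandAlgorithm.output_congr (A : P.RandAlgorithm Λ) {ω : A.Ω} {f g : P.F}
    (h : ∀ j < A.n f ω, A.L j ω g = A.L j ω f) : A.output g ω = A.output f ω := by
  -- The type of the data vector depends on the number of evaluations, so that number is generalized
  -- before it is replaced.
  have key : ∀ m, m = A.n f ω → A.φ ω m (fun j => A.L j ω g) = A.output f ω := by
    rintro m rfl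
    rw [RandAlgorithm.output]
    congr 1
    ext j
    exact h j j.2
  exact key _ (A.n_congr ω f g h)

lemma RandAlgorithm.lintegral_sq_le_error_sq (A : P.RandAlgorithm Λ) {f : P.F} (hf : ‖f‖ ≤ 1) :
    ∫⁻ ω, ‖P.app f - A.output f ω‖ₑ ^ 2 ∂A.ℙ ≤ A.error ^ 2 := by
  have h1 : (∫⁻ ω, ‖P.app f - A.output f ω‖ₑ ^ 2 ∂A.ℙ) ^ (1 / 2 : ℝ) ≤ A.error :=
    le_iSup₂ (f := fun (f : P.F) (_ : ‖f‖ ≤ 1) =>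
      (∫⁻ ω, ‖P.app f - A.output f ω‖ₑ ^ 2 ∂A.ℙ) ^ (1 / 2 : ℝ)) f hf
  have h2 := ENNReal.rpow_le_rpow h1 (z := 2) (by norm_num)
  rw [← ENNReal.rpow_mul] at h2
  norm_num at h2
  exact h2

lemma RandAlgorithm.lintegral_n_le_card (A : P.RandAlgorithm Λ) {f : P.F} (hf : ‖f‖ ≤ 1) :
    ∫⁻ ω, (A.n f ω : ℝ≥0∞) ∂A.ℙ ≤ A.card :=
  le_iSup₂ (f := fun (f : P.F) (_ : ‖f‖ ≤ 1) => ∫⁻ ω, (A.n f ω : ℝ≥0∞) ∂A.ℙ) f hf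

/-- A lower bound for the error of randomized algorithms: the average over the unit sphere of a
subspace of finite dimension. -/
lemma RandAlgorithm.le_error_sq_add (A : P.RandAlgorithm Λ) (W : Submodule 𝕜 P.F)
    [FiniteDimensional 𝕜 W] (hW0 : Module.finrank 𝕜 W ≠ 0) {τ : ℝ} (hτ : 0 ≤ τ)
    (hW : ∀ f ∈ W, τ * ‖f‖ ≤ ‖P.app f‖) (k : ℕ) :
    ENNReal.ofReal τ ^ 2 * ((Module.finrank 𝕜 W - k : ℕ) / Module.finrank 𝕜 W) ≤
      A.error ^ 2 + ENNReal.ofReal τ ^ 2 * (A.card / (k + 1 : ℕ)) := by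
  set M := Module.finrank 𝕜 W with hM
  have : NeZero M := ⟨hW0⟩
  have : Nontrivial (EuclideanSpace 𝕜 (Fin M)) :=
    Module.nontrivial_of_finrank_pos (R := 𝕜) (by
      rw [finrank_euclideanSpace_fin]; exact Nat.pos_of_ne_zero hW0)
  obtain ⟨ν, hν, h1, hU⟩ := exists_invariant_measure 𝕜 (EuclideanSpace 𝕜 (Fin M))
  -- Orthonormal coordinates identify `W` with Euclidean space; writing `J p` as a combination of
  -- fixed vectors is the form in which the algorithm is known to be jointly measurable.
  obtain ⟨J, v, hJW, hJ⟩ : ∃ (J : EuclideanSpace 𝕜 (Fin M) →ₗᵢ[𝕜] P.F) (v : Fin M → P.F),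
      (∀ p, J p ∈ W) ∧ ∀ p, J p = ∑ i, p i • v i := by
    let u : OrthonormalBasis (Fin M) 𝕜 W := stdOrthonormalBasis 𝕜 W
    refine ⟨W.subtypeₗᵢ.comp u.repr.symm.toLinearIsometry, fun i => u i,
      fun p => (u.repr.symm p).2, fun p => ?_⟩
    change ((u.repr.symm p : W) : P.F) = _
    rw [← u.sum_repr_symm p]
    simp
  obtain ⟨T, hT⟩ : ∃ T : EuclideanSpace 𝕜 (Fin M) →L[𝕜] P.G, ∀ p, T p = P.app (J p) :=
    ⟨P.appL ∘L J.toContinuousLinearMap, fun p => rfl⟩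
  have hpair : Measurable fun q : EuclideanSpace 𝕜 (Fin M) × A.Ω =>
      ((fun i => q.1 i : Fin M → 𝕜), q.2) := by fun_prop
  have hn : Measurable fun q : EuclideanSpace 𝕜 (Fin M) × A.Ω => A.n (J q.1) q.2 := by
    simp_rw [hJ]
    exact (A.measurable_n M v).comp hpair
  have hout : StronglyMeasurable fun q : EuclideanSpace 𝕜 (Fin M) × A.Ω =>
      A.output (J q.1) q.2 := by
    simp_rw [hJ]
    exact (A.stronglyMeasurable_output M v).comp_measurable hpair
  have herr : Measurable fun q : EuclideanSpace 𝕜 (Fin M) × A.Ω =>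
      ‖T q.1 - A.output (J q.1) q.2‖ₑ :=
    ((T.continuous.stronglyMeasurable.comp_measurable measurable_fst).sub hout).enorm
  have hint := le_lintegral_lintegral_enorm_sub_sq (ℙ := A.ℙ) h1 hU (T : _ →ₗ[𝕜] P.G) hτ
    (fun p => by
      have := hW (J p) (hJW p)
      rw [J.norm_map, ← hT] at this
      exact this)
    (fun j ω => A.L j ω ∘ₗ J.toLinearMap) (fun p ω => A.n (J p) ω) (fun p ω => A.output (J p) ω)
    hn herr (fun ω p p' hpp => ⟨A.n_congr ω _ _ hpp, A.output_congr hpp⟩) k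
  have hnorm : ∀ᵐ p ∂ν, ‖J p‖ ≤ 1 := by
    filter_upwards [h1] with p hp
    rw [J.norm_map, hp]
  refine hint.trans ?_
  have hle : ∀ {h : EuclideanSpace 𝕜 (Fin M) → ℝ≥0∞} {B : ℝ≥0∞},
      (∀ p, ‖J p‖ ≤ 1 → h p ≤ B) → ∫⁻ p, h p ∂ν ≤ B := by
    intro h B hB
    calc _ ≤ ∫⁻ _p, B ∂ν := lintegral_mono_ae (hnorm.mono fun p hp => hB p hp)
      _ = B := by rw [lintegral_const, measure_univ, mul_one]
  refine add_le_add (hle fun p hp => ?_) ?_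
  · simp only [ContinuousLinearMap.coe_coe, hT]
    exact A.lintegral_sq_le_error_sq hp
  · gcongr
    exact hle fun p hp => A.lintegral_n_le_card hp

/-- Randomized algorithms need almost as much information as is needed to determine the elements
of a subspace on which the embedding is bounded from below. -/
theorem le_minError_ran (W : Submodule 𝕜 P.F) [FiniteDimensional 𝕜 W] {τ : ℝ} (hτ : 0 ≤ τ)
    (hW : ∀ f ∈ W, τ * ‖f‖ ≤ ‖P.app f‖) {n K : ℕ} (hn : n ≠ 0) (hK : 2 ≤ K)
    (hM : K ^ 2 * n ≤ Module.finrank 𝕜 W) :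
    ENNReal.ofReal (√(1 - 2 / K) * τ) ≤ P.minError .ran Λ n := by
  rw [minError, if_neg hn]
  refine le_iInf₂ fun A hA => ?_
  set M := Module.finrank 𝕜 W
  have hM0 : M ≠ 0 := by
    have : 0 < K ^ 2 * n := by positivity
    lia
  have hMR : (K : ℝ) ^ 2 * n ≤ M := by exact_mod_cast hM
  have hKR : (2 : ℝ) ≤ K := by exact_mod_cast hK
  have hnR : (0 : ℝ) < n := by exact_mod_cast Nat.pos_of_ne_zero hn
  have hMpos : (0 : ℝ) < M := by exact_mod_cast Nat.pos_of_ne_zero hM0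
  -- The cut-off `k = K * n` balances two losses of at most `1 / K`: exceeding the cut-off, by
  -- Markov, and the share `K * n / M` of dimensions seen by `k` functionals.
  have h1 := A.le_error_sq_add W hM0 hτ hW (K * n)
  have hcard : A.card / (K * n + 1 : ℕ) ≤ ENNReal.ofReal (1 / K) := by
    calc A.card / (K * n + 1 : ℕ) ≤ (n : ℝ≥0∞) / (K * n : ℕ) := by
          gcongr
          lia
      _ = ENNReal.ofReal (n / (K * n : ℕ)) := by
          rw [ENNReal.ofReal_div_of_pos (by push_cast; positivity), ENNReal.ofReal_natCast,
            ENNReal.ofReal_natCast]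
      _ = _ := by
          congr 1
          push_cast
          field_simp
  have hlow : ENNReal.ofReal (1 - 1 / K) ≤ ((M - K * n : ℕ) : ℝ≥0∞) / M := by
    rw [← ENNReal.ofReal_natCast, ← ENNReal.ofReal_natCast M, ← ENNReal.ofReal_div_of_pos hMpos]
    refine ENNReal.ofReal_le_ofReal ?_
    rw [le_div_iff₀ hMpos]
    have h2 : (M : ℝ) ≤ (M - K * n : ℕ) + K * n := by exact_mod_cast le_tsub_add (a := K * n) (b := M)
    have h3 : (K : ℝ) * n ≤ 1 / K * M := by
      rw [one_div, inv_mul_eq_div, le_div_iff₀ (by positivity)]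
      nlinarith
    linarith
  have h4 : ENNReal.ofReal (τ ^ 2 * (1 - 1 / K)) ≤
      A.error ^ 2 + ENNReal.ofReal (τ ^ 2 * (1 / K)) := by
    rw [ENNReal.ofReal_mul (by positivity), ENNReal.ofReal_mul (by positivity),
      ENNReal.ofReal_pow hτ]
    refine le_trans ?_ (h1.trans ?_)
    · gcongr
    · gcongr
  have h5 : ENNReal.ofReal (√(1 - 2 / K) * τ) ^ 2 ≤ A.error ^ 2 := by
    have h6 : 0 ≤ 1 - 2 / (K : ℝ) := by
      rw [sub_nonneg, div_le_one (by positivity)]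
      exact hKR
    rw [← ENNReal.ofReal_pow (by positivity), mul_pow, Real.sq_sqrt h6]
    have h7 : (1 - 2 / (K : ℝ)) * τ ^ 2 = τ ^ 2 * (1 - 1 / K) - τ ^ 2 * (1 / K) := by ring
    rw [h7, ENNReal.ofReal_sub _ (by positivity)]
    exact tsub_le_iff_right.2 h4
  exact (ENNReal.pow_le_pow_left_iff two_ne_zero).1 h5

end ApproxProblem

end RandomizedLowerBound

/-! ### Minimal errors in terms of the splitting subspace -/

section MinimalErrors

namespace ApproxProblem

variable {𝕜 : Type*} [RCLike 𝕜] {d : ℕ} (P : ApproxProblem 𝕜 d)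

lemma minError_zero (σ : Setting) (Λ : InfoClass) : P.minError σ Λ 0 = P.initialError := by
  simp [minError]

lemma initialError_le {τ : ℝ} (h : ∀ f, ‖P.app f‖ ≤ τ * ‖f‖) :
    P.initialError ≤ ENNReal.ofReal τ := by
  refine iSup₂_le fun f hf => ?_
  rw [← ofReal_norm]
  have hτ : 0 ≤ τ * ‖f‖ := (norm_nonneg _).trans (h f)
  rcases le_or_gt 0 τ with h0 | h0
  · exact ENNReal.ofReal_le_ofReal ((h f).trans (mul_le_of_le_one_right h0 hf))
  · have : ‖f‖ = 0 := by nlinarith [norm_nonneg f]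
    have h1 := h f
    rw [this, mul_zero] at h1
    rw [ENNReal.ofReal_of_nonpos h1]
    exact zero_le

lemma initialError_lt_top : P.initialError < ⊤ :=
  (P.initialError_le (τ := ‖P.appL‖) fun f => P.appL.le_opNorm f).trans_lt ENNReal.ofReal_lt_top

variable {P}

lemma minError_wor_all_le (W : Submodule 𝕜 P.F) [FiniteDimensional 𝕜 W] {τ : ℝ} (hτ : 0 ≤ τ)
    (hW : ∀ f ∈ Wᗮ, ‖P.app f‖ ≤ τ * ‖f‖) :
    P.minError .wor .all (Module.finrank 𝕜 W) ≤ ENNReal.ofReal τ := by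
  by_cases hn : Module.finrank 𝕜 W = 0
  · rw [hn, minError_zero]
    have hbot : W = ⊥ := Submodule.finrank_eq_zero.1 hn
    exact P.initialError_le fun f => hW f (by simp [hbot])
  · rw [minError, if_neg hn]
    let u := stdOrthonormalBasis 𝕜 W
    let A : P.DetAlgorithm .all (Module.finrank 𝕜 W) :=
      { L := fun j => (innerSL 𝕜 (u j : P.F)).toLinearMap
        L_mem := fun j => Set.mem_univ _
        φ := fun y => ∑ j, y j • P.appL (u j)
        stronglyMeasurable_φ := by
          refine Continuous.stronglyMeasurable ?_
          fun_prop }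
    refine (iInf_le _ A).trans (iSup₂_le fun f hf => ?_)
    have h1 : (A.φ fun j => A.L j f) = P.appL (W.starProjection f) := by
      have h2 : (W.starProjection f : P.F) = ∑ j, inner 𝕜 (u j : P.F) f • (u j : P.F) := by
        rw [u.starProjection_eq_sum_rankOne]
        simp
      rw [h2, map_sum]
      simp only [map_smul]
      rfl
    have h3 : P.app f - P.appL (W.starProjection f) = P.app (f - W.starProjection f) := by
      rw [← appL_apply, ← appL_apply, map_sub]
    rw [h1, h3, ← ofReal_norm]
    refine ENNReal.ofReal_le_ofReal ((hW _ (W.sub_starProjection_mem_orthogonal f)).trans ?_)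
    refine mul_le_of_le_one_right hτ (le_trans ?_ hf)
    have h4 : f - W.starProjection f = Wᗮ.starProjection f := by
      rw [Submodule.starProjection_orthogonal_val]
    rw [h4]
    exact Submodule.norm_starProjection_apply_le _ _

/-- With fewer functionals than dimensions, some unit `f` in `W` has zero data. Then `f` and `-f`
receive the same output although their images are at least `2 * τ` apart. -/
lemma finrank_le_of_minError_wor_lt (W : Submodule 𝕜 P.F) [FiniteDimensional 𝕜 W] {τ : ℝ}
    (hW : ∀ f ∈ W, τ * ‖f‖ ≤ ‖P.app f‖) {n : ℕ} {Λ : InfoClass}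
    (h : P.minError .wor Λ n < ENNReal.ofReal τ) : Module.finrank 𝕜 W ≤ n := by
  have hτ : 0 < τ := by
    rw [← ENNReal.ofReal_pos]
    exact zero_le.trans_lt h
  by_contra! hlt
  have hker : ∀ L : Fin n → P.F →ₗ[𝕜] 𝕜, ∃ f ∈ W, ‖f‖ = 1 ∧ ∀ j, L j f = 0 := by
    intro L
    let l : W →ₗ[𝕜] (Fin n → 𝕜) := LinearMap.pi fun j => L j ∘ₗ W.subtype
    have hl : LinearMap.ker l ≠ ⊥ := by
      refine LinearMap.ker_ne_bot_of_finrank_lt ?_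
      rwa [Module.finrank_fin_fun]
    obtain ⟨f, hf, hf0⟩ := (LinearMap.ker l).ne_bot_iff.1 hl
    have hf1 : (f : P.F) ≠ 0 := by simpa using hf0
    refine ⟨((‖(f : P.F)‖⁻¹ : ℝ) : 𝕜) • (f : P.F), W.smul_mem _ f.2, ?_, fun j => ?_⟩
    · rw [norm_smul]
      simp [hf1]
    · have h5 := congr_fun (LinearMap.mem_ker.1 hf) j
      have h6 : L j (f : P.F) = 0 := h5
      rw [map_smul, h6, smul_zero]
  have hlow : ∀ L : Fin n → P.F →ₗ[𝕜] 𝕜, ∀ φ : (Fin n → 𝕜) → P.G,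
      ENNReal.ofReal τ ≤ ⨆ (f : P.F) (_ : ‖f‖ ≤ 1), ‖P.app f - φ fun j => L j f‖ₑ := by
    intro L φ
    obtain ⟨f, hfW, hf1, hf⟩ := hker L
    set S := ⨆ (f : P.F) (_ : ‖f‖ ≤ 1), ‖P.app f - φ fun j => L j f‖ₑ
    have hS : ∀ g : P.F, ‖g‖ ≤ 1 → ‖P.app g - φ fun j => L j g‖ₑ ≤ S := fun g hg =>
      le_iSup₂ (f := fun (f : P.F) (_ : ‖f‖ ≤ 1) => ‖P.app f - φ fun j => L j f‖ₑ) g hg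
    have h1 := hS f hf1.le
    have h2 := hS (-f) (by rw [norm_neg, hf1])
    have h3 : (fun j => L j f) = 0 := funext hf
    have h4 : (fun j => L j (-f)) = 0 := funext fun j => by rw [map_neg, hf]; simp
    have h5 : P.app (-f) = - P.app f := by rw [← appL_apply, map_neg, appL_apply]
    rw [h3] at h1
    rw [h4, h5] at h2
    have h6 : (2 : ℝ≥0∞) * ENNReal.ofReal τ ≤ 2 * S := by
      calc (2 : ℝ≥0∞) * ENNReal.ofReal τ ≤ 2 * ‖P.app f‖ₑ := by
            gcongr
            rw [← ofReal_norm]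
            refine ENNReal.ofReal_le_ofReal ?_
            have := hW f hfW
            rwa [hf1, mul_one] at this
        _ = ‖(P.app f - φ 0) - (-P.app f - φ 0)‖ₑ := by
            have : (P.app f - φ 0) - (-P.app f - φ 0) = (2 : 𝕜) • P.app f := by
              rw [two_smul]; abel
            rw [this, enorm_smul]
            congr 1
            rw [← ofReal_norm]
            simp
        _ ≤ ‖P.app f - φ 0‖ₑ + ‖-P.app f - φ 0‖ₑ := enorm_sub_le
        _ ≤ 2 * S := by rw [two_mul]; exact add_le_add h1 h2
    exact (ENNReal.mul_le_mul_iff_right (by simp) (by simp)).1 h6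
  refine h.not_ge ?_
  rw [minError]
  split_ifs with hn
  · refine (hlow 0 0).trans ?_
    simp [initialError]
  · exact le_iInf fun A => hlow A.L A.φ

/-- Sampling works in `L₂`, so `W` is replaced by its image `V`, whose dimension is the `n` found.
The orthogonal projection onto `V` is at least as good as the image of the projection onto `W`,
hence inherits the bound `τ`. -/
lemma exists_minError_ran_std_le (W : Submodule 𝕜 P.F) [FiniteDimensional 𝕜 W] {τ : ℝ}
    (hτ : 0 ≤ τ) (hW : ∀ f ∈ Wᗮ, ‖P.app f‖ ≤ τ * ‖f‖) {K : ℕ} (hK : 2 ≤ K) :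
    ∃ n ≤ Module.finrank 𝕜 W, P.minError .ran .std (n * (1 + K * (Nat.clog 2 n + 1))) ≤
      ENNReal.ofReal (√(1 + 3 / K) * τ) := by
  let V : Submodule 𝕜 P.G := W.map P.appL.toLinearMap
  refine ⟨Module.finrank 𝕜 V, Submodule.finrank_map_le _ _, ?_⟩
  let u := stdOrthonormalBasis 𝕜 V
  have hVsum : ∀ g : P.G, V.starProjection g = ∑ j, inner 𝕜 (u j : P.G) g • (u j : P.G) := by
    intro g
    rw [u.starProjection_eq_sum_rankOne]
    simp
  have hbound : ∀ f, ‖P.app f - V.starProjection (P.app f)‖ ≤ τ * ‖f‖ := by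
    intro f
    have h1 : ‖P.app f - V.starProjection (P.app f)‖ ≤ ‖P.app f - P.appL (W.starProjection f)‖ := by
      rw [V.starProjection_minimal]
      exact ciInf_le ⟨0, by rintro _ ⟨_, rfl⟩; exact norm_nonneg _⟩
        (⟨P.appL (W.starProjection f), _, W.starProjection_apply_mem f, rfl⟩ : V)
    have h3 : P.app f - P.appL (W.starProjection f) = P.app (f - W.starProjection f) := by
      rw [← appL_apply, ← appL_apply, map_sub]
    rw [h3] at h1
    refine h1.trans ((hW _ (W.sub_starProjection_mem_orthogonal f)).trans ?_)
    have h4 : f - W.starProjection f = Wᗮ.starProjection f := by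
      rw [Submodule.starProjection_orthogonal_val]
    rw [h4]
    gcongr
    exact Submodule.norm_starProjection_apply_le _ _
  by_cases hn : Module.finrank 𝕜 V = 0
  · have hbot : V = ⊥ := Submodule.finrank_eq_zero.1 hn
    rw [hn, zero_mul, minError_zero]
    refine (P.initialError_le fun f => ?_).trans (ENNReal.ofReal_le_ofReal
      (le_mul_of_one_le_left hτ ?_))
    · have := hbound f
      rwa [hVsum, Finset.sum_eq_zero, sub_zero] at this
      intro j _
      exact absurd j.2 (by omega)
    · rw [Real.one_le_sqrt]
      have : 0 ≤ 3 / (K : ℝ) := by positivity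
      linarith
  · refine minError_ran_std_le (e := fun j => (u j : P.G)) ?_ hn hτ (fun f => ?_) hK
    · exact u.orthonormal.comp_linearIsometry V.subtypeₗᵢ
    · rw [← hVsum]
      exact hbound f

lemma minError_ran_all_le (n : ℕ) : P.minError .ran .all n ≤ P.minError .ran .std n := by
  rw [minError, minError]
  split_ifs with hn
  · exact le_rfl
  · refine le_iInf₂ fun A hA => ?_
    let B : P.RandAlgorithm .all := { A with L_mem := fun _ _ => Set.mem_univ _ }
    exact iInf₂_le B hA

end ApproxProblem

end MinimalErrors

/-! ### Comparison of the information complexities -/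

section InformationComplexity

namespace ApproxProblem

variable {𝕜 : Type*} [RCLike 𝕜] {d : ℕ} (P : ApproxProblem 𝕜 d) (σ : Setting) (Λ : InfoClass)
  (c : Criterion)

/-- The factor `CRI` as a real number; it is the same in all settings. -/
def realCri : ℝ := (P.cri .wor .all c).toReal

lemma realCri_nonneg : 0 ≤ P.realCri c := ENNReal.toReal_nonneg

lemma cri_eq_ofReal : P.cri σ Λ c = ENNReal.ofReal (P.realCri c) := by
  rw [realCri, ENNReal.ofReal_toReal] <;> cases c <;>
    simp [cri, minError_zero, P.initialError_lt_top.ne]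

variable {P σ Λ c}

lemma mem_admissible_iff {ε : ℝ} (hε : 0 ≤ ε) {n : ℕ} :
    n ∈ P.admissible σ Λ c ε ↔ P.minError σ Λ n ≤ ENNReal.ofReal (ε * P.realCri c) := by
  rw [admissible, Set.mem_ofPred_eq, cri_eq_ofReal, ENNReal.ofReal_mul hε]

/-- This happens only for the normalized criterion with zero initial error, where the zero algorithm
is exact. It is split off because the splitting needs a positive threshold. -/
lemma zero_mem_admissible_of_realCri_eq_zero (h : P.realCri c = 0) (ε : ℝ) :
    0 ∈ P.admissible σ Λ c ε := by
  have h0 : P.cri σ Λ c = 0 := by rw [cri_eq_ofReal, h, ENNReal.ofReal_zero]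
  rw [admissible, Set.mem_ofPred_eq, h0, mul_zero]
  cases c
  · simp [cri] at h0
  · exact h0.le

lemma admissible_subset {ε ε' : ℝ} (h : ε ≤ ε') :
    P.admissible σ Λ c ε ⊆ P.admissible σ Λ c ε' := fun n hn =>
  le_trans (b := ENNReal.ofReal ε * P.cri σ Λ c) hn (by gcongr)

lemma admissible_ran_std_subset {ε : ℝ} :
    P.admissible .ran .std c ε ⊆ P.admissible .ran .all c ε := fun n hn => by
  rw [admissible, Set.mem_ofPred_eq, cri_eq_ofReal] at hn ⊢
  exact (minError_ran_all_le n).trans hn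

lemma exists_splitting (P : ApproxProblem 𝕜 d) {τ : ℝ} (hτ : 0 < τ) :
    ∃ W : Submodule 𝕜 P.F, FiniteDimensional 𝕜 W ∧ (∀ f ∈ W, τ * ‖f‖ ≤ ‖P.app f‖) ∧
      ∀ f ∈ Wᗮ, ‖P.app f‖ ≤ τ * ‖f‖ := by
  obtain ⟨W, hW, h1, h2⟩ := exists_spectral_splitting P.appL P.isCompactOperator_appL hτ
  refine ⟨W, hW, fun f hf => ?_, h2⟩
  by_cases h0 : f = 0
  · simp [h0]
  · exact (h1 f hf h0).le

lemma admissible_wor_all_nonempty {ε : ℝ} (hε : 0 < ε) :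
    (P.admissible .wor .all c ε).Nonempty := by
  rcases (P.realCri_nonneg c).eq_or_lt' with h0 | h0
  · exact ⟨0, zero_mem_admissible_of_realCri_eq_zero h0 ε⟩
  · obtain ⟨W, hW, -, h⟩ := P.exists_splitting (mul_pos hε h0)
    exact ⟨_, (mem_admissible_iff hε.le).2 (minError_wor_all_le W (by positivity) h)⟩

/-- Function values in the randomized setting are, up to a logarithmic factor, as good as arbitrary
linear information in the worst case setting. -/
lemma exists_mem_admissible_ran_std {ε δ : ℝ} (hε : 0 < ε) (hδ0 : 0 < δ) (hδ1 : δ < 1) {K : ℕ}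
    (hK : 2 ≤ K) (hKδ : √(1 + 3 / K) * ((1 + δ) / 2) ≤ 1) :
    ∃ m ≤ P.infoComplexity .wor .all c (δ * ε),
      m * (1 + K * (Nat.clog 2 m + 1)) ∈ P.admissible .ran .std c ε := by
  rcases (P.realCri_nonneg c).eq_or_lt' with h0 | h0
  · exact ⟨0, Nat.zero_le _, by simpa using zero_mem_admissible_of_realCri_eq_zero h0 ε⟩
  set κ := P.realCri c
  -- The threshold is the midpoint of `δ * ε * κ` and `ε * κ`: strictly above the first, so that
  -- `dim W` is bounded by the worst case complexity, and below the second, leaving room for the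
  -- factor `√(1 + 3 / K)`.
  have hτ : 0 < (1 + δ) / 2 * (ε * κ) := by positivity
  obtain ⟨W, hW, h1, h2⟩ := P.exists_splitting hτ
  obtain ⟨m, hm, hmin⟩ := exists_minError_ran_std_le W hτ.le h2 hK
  refine ⟨m, hm.trans (finrank_le_of_minError_wor_lt (Λ := .all) W h1 ?_),
    (mem_admissible_iff hε.le).2 (hmin.trans (ENNReal.ofReal_le_ofReal ?_))⟩
  · refine ((mem_admissible_iff (by positivity)).1 (Nat.sInf_mem
      (admissible_wor_all_nonempty (by positivity)))).trans_lt ?_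
    rw [ENNReal.ofReal_lt_ofReal_iff hτ, mul_assoc]
    gcongr
    linarith
  · rw [← mul_assoc]
    exact mul_le_of_le_one_left (by positivity) hKδ

lemma admissible_ran_std_nonempty {ε : ℝ} (hε : 0 < ε) :
    (P.admissible .ran .std c ε).Nonempty := by
  -- Any admissible pair serves for mere existence; for `δ = 1 / 8` and `K = 2` the requirement
  -- reads `√(5 / 2) * (9 / 16) ≤ 1`.
  obtain ⟨m, -, hm⟩ := exists_mem_admissible_ran_std (P := P) (c := c) hε (δ := 1 / 8) (K := 2)
    (by norm_num) (by norm_num) le_rfl (by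
      have : √(1 + 3 / ((2 : ℕ) : ℝ)) ≤ 16 / 9 := by
        rw [Real.sqrt_le_left (by norm_num)]
        norm_num
      linarith)
  exact ⟨_, hm⟩

/-- Randomized algorithms that use arbitrary linear information cannot do much better than
deterministic algorithms. -/
lemma infoComplexity_wor_all_le {ε δ : ℝ} (hε : 0 < ε) (hδ0 : 0 < δ) (hδ1 : δ < 1) {K : ℕ}
    (hK : 2 ≤ K) (hKδ : δ < √(1 - 2 / K)) :
    P.infoComplexity .wor .all c ε ≤ K ^ 2 * P.infoComplexity .ran .all c (δ * ε) := by
  rcases (P.realCri_nonneg c).eq_or_lt' with h0 | h0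
  · exact (Nat.sInf_le (zero_mem_admissible_of_realCri_eq_zero h0 ε)).trans (Nat.zero_le _)
  have hτ : 0 < ε * P.realCri c := by positivity
  have hn := Nat.sInf_mem ((admissible_ran_std_nonempty (P := P) (c := c) (mul_pos hδ0 hε)).mono
    admissible_ran_std_subset)
  change P.infoComplexity .ran .all c (δ * ε) ∈ _ at hn
  set n := P.infoComplexity .ran .all c (δ * ε)
  rw [mem_admissible_iff (by positivity)] at hn
  obtain ⟨W, hW, h1, h2⟩ := P.exists_splitting hτ
  -- The lower bound covers only `n ≠ 0`. Without information the only algorithm is zero, and its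
  -- error is the same in both settings.
  by_cases hn0 : n = 0
  · rw [hn0, minError_zero] at hn
    refine (Nat.sInf_le (?_ : 0 ∈ _)).trans (Nat.zero_le _)
    rw [mem_admissible_iff hε.le, minError_zero]
    refine hn.trans (ENNReal.ofReal_le_ofReal ?_)
    rw [mul_assoc]
    exact mul_le_of_le_one_left hτ.le hδ1.le
  · refine (Nat.sInf_le ((mem_admissible_iff hε.le).2 (minError_wor_all_le W hτ.le h2))).trans ?_
    by_contra! hlt
    have h3 := (le_minError_ran (Λ := .all) W hτ.le h1 hn0 hK hlt.le).trans hn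
    rw [ENNReal.ofReal_le_ofReal_iff (by positivity), mul_assoc, mul_le_mul_iff_left₀ hτ] at h3
    exact h3.not_gt hKδ

lemma infoComplexity_ran_all_le {ε ε' : ℝ} (hε : 0 < ε') (h : ε' ≤ ε) :
    P.infoComplexity .ran .all c ε ≤ P.infoComplexity .ran .std c ε' :=
  Nat.sInf_le (admissible_subset h (admissible_ran_std_subset
    (Nat.sInf_mem (admissible_ran_std_nonempty hε))))

end ApproxProblem

lemma clog_two_le {m : ℕ} (hm : m ≠ 0) {η : ℝ} (hη : 0 < η) :
    (Nat.clog 2 m : ℝ) ≤ (m : ℝ) ^ η / (η * Real.log 2) + 1 := by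
  have hm1 : (1 : ℝ) ≤ m := by exact_mod_cast Nat.one_le_iff_ne_zero.2 hm
  have h2 : (0 : ℝ) < Real.log 2 := Real.log_pos one_lt_two
  rw [← Real.natCeil_logb_natCast]
  refine (Nat.ceil_lt_add_one (Real.logb_nonneg one_lt_two hm1)).le.trans ?_
  gcongr
  rw [Real.logb, ← div_div]
  gcongr
  exact Real.log_le_rpow_div (by positivity) hη

/-- A logarithm is bounded by any positive power; this is where the oversampling factor turns into
the loss `η` in the exponent. -/
lemma exists_mul_clog_le (K : ℕ) {η : ℝ} (hη : 0 < η) :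
    ∃ C : ℝ, 0 < C ∧ ∀ m : ℕ,
      ((m * (1 + K * (Nat.clog 2 m + 1)) : ℕ) : ℝ) ≤ C * (m : ℝ) ^ (1 + η) := by
  have h2 : (0 : ℝ) < Real.log 2 := Real.log_pos one_lt_two
  refine ⟨1 + K * (1 / (η * Real.log 2) + 2), by positivity, fun m => ?_⟩
  by_cases hm : m = 0
  · simp only [hm, zero_mul, Nat.cast_zero]
    positivity
  have hm1 : (1 : ℝ) ≤ m := by exact_mod_cast Nat.one_le_iff_ne_zero.2 hm
  have h1 : (1 : ℝ) ≤ (m : ℝ) ^ η := Real.one_le_rpow hm1 hη.le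
  rw [Real.rpow_add (by positivity), Real.rpow_one]
  push_cast
  rw [mul_left_comm]
  gcongr
  have h3 : (Nat.clog 2 m : ℝ) + 1 ≤ (1 / (η * Real.log 2) + 2) * (m : ℝ) ^ η := by
    have := clog_two_le hm hη
    rw [add_mul, one_div_mul_eq_div]
    linarith
  calc 1 + (K : ℝ) * (Nat.clog 2 m + 1) ≤
      (m : ℝ) ^ η + K * ((1 / (η * Real.log 2) + 2) * (m : ℝ) ^ η) := by gcongr
    _ = _ := by ring

lemma natCast_le_rpow (m : ℕ) {η : ℝ} (hη : 0 ≤ η) : (m : ℝ) ≤ (m : ℝ) ^ (1 + η) := by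
  by_cases hm : m = 0
  · rw [hm, Nat.cast_zero]
    positivity
  · exact Real.self_le_rpow_of_one_le (by exact_mod_cast Nat.one_le_iff_ne_zero.2 hm) (by linarith)

section Complexity

variable {𝕜 : Type*} [RCLike 𝕜] (APP : (d : ℕ+) → ApproxProblem 𝕜 d) (c : Criterion)

/-- Since `√(1 - 2 / K)` tends to `1`, some `K` puts it above `δ`; the price is only the constant `K
^ 2`. -/
theorem dominated_wor_all_ran_all :
    Dominated (complexity APP .wor .all c) (complexity APP .ran .all c) := by
  intro δ η hδ0 hδ1 hη
  have hlim : Tendsto (fun K : ℕ => √(1 - 2 / (K : ℝ))) atTop (𝓝 1) := by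
    have := ((tendsto_const_div_atTop_nhds_zero_nat 2).const_sub (1 : ℝ)).sqrt
    simpa using this
  obtain ⟨K, hK, hKδ⟩ :=
    ((eventually_ge_atTop 2).and (hlim.eventually (lt_mem_nhds hδ1))).exists
  refine ⟨K ^ 2, by positivity, fun d ε h0 h1 => ?_⟩
  have h := ApproxProblem.infoComplexity_wor_all_le (P := APP d) (c := c) h0 hδ0 hδ1 hK hKδ
  calc (complexity APP .wor .all c ε d : ℝ) ≤ K ^ 2 * complexity APP .ran .all c (δ * ε) d := by
        exact_mod_cast h
    _ ≤ _ := by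
        gcongr
        exact natCast_le_rpow _ hη.le

theorem dominated_ran_all_ran_std :
    Dominated (complexity APP .ran .all c) (complexity APP .ran .std c) := by
  intro δ η hδ0 hδ1 hη
  refine ⟨1, one_pos, fun d ε h0 h1 => ?_⟩
  have h : complexity APP .ran .all c ε d ≤ complexity APP .ran .std c (δ * ε) d :=
    ApproxProblem.infoComplexity_ran_all_le (mul_pos hδ0 h0) (mul_le_of_le_one_left h0.le hδ1.le)
  rw [one_mul]
  exact (Nat.cast_le.2 h).trans (natCast_le_rpow _ hη.le)

/-- Since `(1 + δ) / 2 < 1`, a large `K` makes the oversampled method meet the demand `ε`, with `K`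
depending on `δ` alone and hence uniform in `d`. -/
theorem dominated_ran_std_wor_all :
    Dominated (complexity APP .ran .std c) (complexity APP .wor .all c) := by
  intro δ η hδ0 hδ1 hη
  have hlim : Tendsto (fun K : ℕ => √(1 + 3 / (K : ℝ)) * ((1 + δ) / 2)) atTop
      (𝓝 ((1 + δ) / 2)) := by
    have := (((tendsto_const_div_atTop_nhds_zero_nat 3).const_add (1 : ℝ)).sqrt).mul_const
      ((1 + δ) / 2)
    simpa using this
  obtain ⟨K, hK, hKδ⟩ := ((eventually_ge_atTop 2).and
    (hlim.eventually (gt_mem_nhds (show (1 + δ) / 2 < 1 by linarith)))).exists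
  obtain ⟨C, hC, h⟩ := exists_mul_clog_le K hη
  refine ⟨C, hC, fun d ε h0 h1 => ?_⟩
  obtain ⟨m, hm, hadm⟩ := ApproxProblem.exists_mem_admissible_ran_std (P := APP d) (c := c)
    h0 hδ0 hδ1 hK hKδ.le
  calc (complexity APP .ran .std c ε d : ℝ) ≤ (m * (1 + K * (Nat.clog 2 m + 1)) : ℕ) :=
        Nat.cast_le.2 (Nat.sInf_le hadm)
    _ ≤ C * (m : ℝ) ^ (1 + η) := h m
    _ ≤ _ := by
        gcongr
        exact hm

end Complexity

end InformationComplexity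

end Tractability

end
theorem corollary2p7 {𝕜 : Type*} [RCLike 𝕜] (APP : (d : ℕ+) → ApproxProblem 𝕜 d)
    (c : Criterion) :
    -- the information complexities are finite
    (∀ (d : ℕ+) (ε : ℝ), 0 < ε → ε < 1 →
      ((APP d).admissible .wor .all c ε).Nonempty ∧
      ((APP d).admissible .ran .all c ε).Nonempty ∧
      ((APP d).admissible .ran .std c ε).Nonempty) ∧
    -- equivalences and equality of the exponents, for ALG and for EXP
    ∀ s : Scale,
      [SPT s (complexity APP .wor .all c), SPT s (complexity APP .ran .all c),
        SPT s (complexity APP .ran .std c)].TFAE ∧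
      [PT s (complexity APP .wor .all c), PT s (complexity APP .ran .all c),
        PT s (complexity APP .ran .std c)].TFAE ∧
      [QPT s (complexity APP .wor .all c), QPT s (complexity APP .ran .all c),
        QPT s (complexity APP .ran .std c)].TFAE ∧
      [UWT s (complexity APP .wor .all c), UWT s (complexity APP .ran .all c),
        UWT s (complexity APP .ran .std c)].TFAE ∧
      [WT s (complexity APP .wor .all c), WT s (complexity APP .ran .all c),
        WT s (complexity APP .ran .std c)].TFAE ∧
      (∀ α β : ℝ, 0 < α → 0 < β →
        [STWT s (complexity APP .wor .all c) α β, STWT s (complexity APP .ran .all c) α β,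
          STWT s (complexity APP .ran .std c) α β].TFAE) ∧
      (sptExponent s (complexity APP .wor .all c) = sptExponent s (complexity APP .ran .all c) ∧
        sptExponent s (complexity APP .ran .all c) = sptExponent s (complexity APP .ran .std c)) ∧
      (qptExponent s (complexity APP .wor .all c) = qptExponent s (complexity APP .ran .all c) ∧
        qptExponent s (complexity APP .ran .all c) =
          qptExponent s (complexity APP .ran .std c)) := by
  have h₁₂ := dominated_wor_all_ran_all APP c
  have h₂₃ := dominated_ran_all_ran_std APP c
  have h₃₁ := dominated_ran_std_wor_all APP c
  refine ⟨fun d ε h0 _ => ⟨ApproxProblem.admissible_wor_all_nonempty h0,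
    (ApproxProblem.admissible_ran_std_nonempty h0).mono ApproxProblem.admissible_ran_std_subset,
    ApproxProblem.admissible_ran_std_nonempty h0⟩, fun s => ⟨?_, ?_, ?_, ?_, ?_, ?_, ?_, ?_⟩⟩
  · exact tfae_of_dominated (fun _ _ h hN => h.of_dominated hN) h₁₂ h₂₃ h₃₁
  · exact tfae_of_dominated (fun _ _ h hN => h.of_dominated hN) h₁₂ h₂₃ h₃₁
  · exact tfae_of_dominated (fun _ _ h hN => h.of_dominated hN) h₁₂ h₂₃ h₃₁
  · exact tfae_of_dominated (fun _ _ h hN => h.of_dominated hN) h₁₂ h₂₃ h₃₁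
  · exact tfae_of_dominated (fun _ _ h hN => h.of_dominated hN) h₁₂ h₂₃ h₃₁
  · exact fun α β hα hβ => tfae_of_dominated (Q := fun N => STWT s N α β)
      (fun _ _ h hN => h.of_dominated hα hβ hN) h₁₂ h₂₃ h₃₁
  · have e₁ := sptExponent_le_of_dominated (s := s) h₁₂
    have e₂ := sptExponent_le_of_dominated (s := s) h₂₃
    have e₃ := sptExponent_le_of_dominated (s := s) h₃₁
    exact ⟨e₁.antisymm (e₂.trans e₃), e₂.antisymm (e₃.trans e₁)⟩
  · have e₁ := qptExponent_le_of_dominated (s := s) h₁₂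
    have e₂ := qptExponent_le_of_dominated (s := s) h₂₃
    have e₃ := qptExponent_le_of_dominated (s := s) h₃₁
    exact ⟨e₁.antisymm (e₂.trans e₃), e₂.antisymm (e₃.trans e₁)⟩
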